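/- For $n\ge 0$ let $V_n$ be the set of arrows $(i,j)$ with $i\ne j$ in $\{1,\dots,n+1\}$; the arrow $(i,j)$, with tail $i$ and head $j$, represents the point $e_j-e_i\in\mathbb R^{n+1}$, and it is forward if $i<j$ and backward if $i>j$. Let $P_n$ be the convex hull of these points (the full root polytope of type $A$). Let $\mathcal F=(\triangle_0,\triangle_1,\dots)$ be a collection of uniform flag triangulations: for each $n$, $\triangle_n$ is a flag simplicial complex on the vertex set $V_n$ (every minimal non-face has cardinality $2$; the empty set is a face) which represents a triangulation of the relative boundary of $P_n$, and whether $\{(i_1,j_1),(i_2,j_2)\}$ is an edge depends only on the equalities and inequalities between $i_1,j_1,i_2,j_2$, by a rule that does not depend on $n$. The type of a pair of arrows on four distinct nodes is the word that records, from left to right, which of the nodes are tails ($T$) and which are heads ($H$). For each type, two of the three possibilities "one arrow lies inside the other" (nest), "the arrows cross", "one arrow is entirely to the left of the other" can occur, and the edges of a uniform triangulation all follow the same one of the two; we say that the type nests, crosses, and so on. Assume that $\mathcal F$ belongs to the Simion class: exactly one of the types $THTH$ and $HTHT$ nests and, if both $THHT$ and $HTTH$ cross, then both $TTHH$ and $HHTT$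 nest. A set $\sigma\subseteq V_n$ is saturated if every node in $\{1,\dots,n+1\}$ is an endpoint of an arrow of $\sigma$; the empty subset of $V_0=\emptyset$ is also saturated. Let $$F(\widehat{\mathcal F},x,y,z)=\sum_{n,i,j\ge 0}\hat f(n,i,j)\,x^iy^jz^n ,$$ where $\hat f(n,i,j)$ is the number of saturated faces of $\triangle_n$ with exactly $i$ forward and $j$ backward arrows, and let $C(u)=\sum_{n\ge 0}\frac{1}{n+1}\binom{2n}{n}u^n$. If the type $THTH$ nests and the type $HTHT$ does not nest, then, as formal power series, $$F(\widehat{\mathcal F},x,y,z)=\frac{C+z}{1+z}+\frac{xz\,(1+zC)\,C^2}{(1+z)\,(1-2Cxz-C^2xz^2)},\qquad C=C(yz(z+1)).$$ If the type $THTH$ does not nest and the type $HTHT$ nests, then the same identity holds with $x$ and $y$ interchanged on the right-hand side, that is, $$F(\widehat{\mathcal F},x,y,z)=\frac{C+z}{1+z}+\frac{yz\,(1+zC)\,C^2}{(1+z)\,(1-2Cyz-C^2yz^2)},\qquad C=C(xz(z+1)).$$ -/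

import Mathlib

namespace RootPolytope

/-! ### Arrows and the root polytope

The nodes `1, …, n+1` are represented by `Fin (n+1)`, with its usual order. -/

/-- The set `V_n` of arrows `(i,j)`, `i ≠ j`, with tail `i` and head `j`. -/
abbrev Arrow (n : ℕ) : Type := {p : Fin (n + 1) × Fin (n + 1) // p.1 ≠ p.2}

/-- The tail `i` of the arrow `(i,j)`. -/
abbrev Arrow.tail {n : ℕ} (p : Arrow n) : Fin (n + 1) := p.1.1

/-- The head `j` of the arrow `(i,j)`. -/
abbrev Arrow.head {n : ℕ} (p : Arrow n) : Fin (n + 1) := p.1.2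

/-- The point `e_j - e_i` represented by the arrow `(i,j)`. -/
def Arrow.point {n : ℕ} (p : Arrow n) : Fin (n + 1) → ℝ :=
  Pi.single p.head 1 - Pi.single p.tail 1

/-- The full root polytope `P_n` of type `A`. -/
def rootPolytope (n : ℕ) : Set (Fin (n + 1) → ℝ) :=
  convexHull ℝ (Set.range (Arrow.point (n := n)))

/-! ### Complexes on the vertex set `V_n`

The empty set counts as a face. -/

/-- `Δ` is a simplicial complex with vertex set `V_n`. -/
structure IsSimplicialComplex {n : ℕ} (Δ : Set (Finset (Arrow n))) : Prop where
  empty_mem : ∅ ∈ Δ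
  singleton_mem : ∀ p : Arrow n, {p} ∈ Δ
  down_closed : ∀ σ ∈ Δ, ∀ τ ⊆ σ, τ ∈ Δ

/-- Flag: every minimal non-face has cardinality `2`. -/
def IsFlag {n : ℕ} (Δ : Set (Finset (Arrow n))) : Prop :=
  ∀ σ : Finset (Arrow n), σ ∉ Δ → (∀ τ ⊂ σ, τ ∈ Δ) → σ.card = 2

/-- `Δ` represents a triangulation, without new vertices, of the (relative) boundary of `P_n`:
the simplices spanned by the non-empty faces of `Δ` form a geometric simplicial complex whose
underlying space is the boundary of `P_n`. -/
def TriangulatesBoundary {n : ℕ} (Δ : Set (Finset (Arrow n))) : Prop :=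
  ∃ K : Geometry.SimplicialComplex ℝ (Fin (n + 1) → ℝ),
    K.faces = {s : Finset (Fin (n + 1) → ℝ) |
      ∃ σ ∈ Δ, σ.Nonempty ∧ (s : Set (Fin (n + 1) → ℝ)) = Arrow.point '' ↑σ} ∧
    K.space = intrinsicFrontier ℝ (rootPolytope n)

/-- A collection `𝓕 = (𝓕_0, 𝓕_1, …)`, where `𝓕_n` is a family of subsets of `V_n`. -/
abbrev Collection : Type := (n : ℕ) → Set (Finset (Arrow n))

/-- The node tuple `(i₁, j₁, i₂, j₂)` of a pair of arrows. -/
def nodes {n : ℕ} (p q : Arrow n) : Fin 4 → Fin (n + 1) :=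
  ![p.tail, p.head, q.tail, q.head]

/-- Whether a pair of arrows `(i₁,j₁)`, `(i₂,j₂)` is an edge depends only on the equalities and
inequalities between `i₁, j₁, i₂, j₂`, by a rule that is the same in every dimension. -/
def IsUniform (F : Collection) : Prop :=
  ∀ (m n : ℕ) (p q : Arrow m) (p' q' : Arrow n),
    (∀ s t : Fin 4, nodes p q s < nodes p q t ↔ nodes p' q' s < nodes p' q' t) →
    (({p, q} : Finset (Arrow m)) ∈ F m ↔ ({p', q'} : Finset (Arrow n)) ∈ F n)

/-- A collection of uniform flag triangulations of the boundaries of the polytopes `P_n`. -/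
structure IsUniformFlagTriangulation (F : Collection) : Prop where
  complex : ∀ n, IsSimplicialComplex (F n)
  flag : ∀ n, IsFlag (F n)
  uniform : IsUniform F
  triangulates : ∀ n, TriangulatesBoundary (F n)

/-! ### Types of pairs of arrows

`T` marks a tail and `H` a head, in the left-to-right order of the four nodes. On four given nodes
of a given type there are two ways to pair the tails with the heads, exactly one of which is an
edge of a triangulation. -/

/-- Pairs of type `THTH` nest. -/
def THTHNest (F : Collection) : Prop :=
  ∀ (n : ℕ) (p q : Arrow n),
    p.tail < q.head → q.head < q.tail → q.tail < p.head → {p, q} ∈ F n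

/-- Pairs of type `HTHT` nest. -/
def HTHTNest (F : Collection) : Prop :=
  ∀ (n : ℕ) (p q : Arrow n),
    p.head < q.tail → q.tail < q.head → q.head < p.tail → {p, q} ∈ F n

/-- Pairs of type `THHT` cross. -/
def THHTCross (F : Collection) : Prop :=
  ∀ (n : ℕ) (p q : Arrow n),
    p.tail < q.head → q.head < p.head → p.head < q.tail → {p, q} ∈ F n

/-- Pairs of type `HTTH` cross. -/
def HTTHCross (F : Collection) : Prop :=
  ∀ (n : ℕ) (p q : Arrow n),
    p.head < q.tail → q.tail < p.tail → p.tail < q.head → {p, q} ∈ F n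

/-- Pairs of type `TTHH` nest. -/
def TTHHNest (F : Collection) : Prop :=
  ∀ (n : ℕ) (p q : Arrow n),
    p.tail < q.tail → q.tail < q.head → q.head < p.head → {p, q} ∈ F n

/-- Pairs of type `HHTT` nest. -/
def HHTTNest (F : Collection) : Prop :=
  ∀ (n : ℕ) (p q : Arrow n),
    p.head < q.head → q.head < q.tail → q.tail < p.tail → {p, q} ∈ F n

/-- The Simion class: exactly one of the types `THTH` and `HTHT` nests and, if both `THHT` and
`HTTH` cross, then both `TTHH` and `HHTT` nest. -/
def SimionClass (F : Collection) : Prop :=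
  Xor (THTHNest F) (HTHTNest F) ∧
    (THHTCross F → HTTHCross F → TTHHNest F ∧ HHTTNest F)

/-! ### Refined face enumeration -/

/-- A set of arrows is saturated if every node is an endpoint of one of its arrows; the empty
subset of `V_0` is also saturated. -/
def IsSaturated {n : ℕ} (σ : Finset (Arrow n)) : Prop :=
  n = 0 ∨ ∀ k : Fin (n + 1), ∃ p ∈ σ, p.tail = k ∨ p.head = k

/-- The collection of the families of saturated sets of `F`. -/
def saturated (F : Collection) : Collection :=
  fun n => {σ | σ ∈ F n ∧ IsSaturated σ}

/-- `f(𝓕_n, i, j)`: the number of sets in the family that consist of `i` forward arrows and `j`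
backward arrows. -/
noncomputable def faceCount {n : ℕ} (Δ : Set (Finset (Arrow n))) (i j : ℕ) : ℕ :=
  Set.ncard {σ | σ ∈ Δ ∧
    (σ.filter fun p => p.tail < p.head).card = i ∧
    (σ.filter fun p => p.head < p.tail).card = j}

/-- The face generating function `∑ f(𝓕_n, i, j) x^i y^j z^n`; the variables `x`, `y`, `z` have the
indices `0`, `1`, `2`. -/
noncomputable def faceSeries (F : Collection) : MvPowerSeries (Fin 3) ℚ :=
  fun m => (faceCount (F (m 2)) (m 0) (m 1) : ℚ)

/-- `C(u)`, the Catalan generating function at a power series `u` with zero constant term. -/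
noncomputable def catalanAt (u : MvPowerSeries (Fin 3) ℚ) : MvPowerSeries (Fin 3) ℚ :=
  (PowerSeries.map (Nat.castRingHom ℚ) PowerSeries.catalanSeries).subst u

/-- With `C = C(yz(z+1))`, the series
`(C + z) / (1 + z) + xz (1 + zC) C² / ((1 + z) (1 - 2Cxz - C²xz²))`. -/
noncomputable def simionSeries (x y z : MvPowerSeries (Fin 3) ℚ) : MvPowerSeries (Fin 3) ℚ :=
  let C := catalanAt (y * z * (z + 1))
  (C + z) * (1 + z)⁻¹ +
    x * z * (1 + z * C) * C ^ 2 *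
      ((1 + z) * (1 - 2 * C * x * z - C ^ 2 * x * z ^ 2))⁻¹

end RootPolytope

/-!
A triangulation of the boundary of the root polytope is a complete fan, and root vectors of type
`A` are totally unimodular. Hence sending a multiset of arrows to its divergence (out-degree minus
in-degree at each node) is a bijection between the multisets supported on faces and the integer
vectors with zero sum. Multisets supported on faces are enumerated by substituting `x / (1 - x)` and
`y / (1 - y)` for `x` and `y` in the face series, and this substitution is injective.

If `THTH` nests and `HTHT` does not, every face admits a cut: a position between two nodes that is
crossed by every forward arrow and by no backward arrow. The number of forward arrows is then the
largest partial sum of the divergence, the total number of arrows is the sum of its positive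
entries, and the face is saturated exactly if the divergence has no zero entry. So one has to count
closed integer paths with nonzero steps by their maximal height and the sum of their up steps.
Splitting such a path at its first maximum and reversing the second half gives two paths all of
whose suffixes have positive, respectively nonnegative, sums. Their generating functions form a
geometric sequence in the height, and the ratio is governed by the Catalan equation.

The case where `HTHT` nests and `THTH` does not follows by reversing all arrows.
-/

namespace RootPolytope

open Finset

/-! ### The boundary of the root polytope -/

lemma mem_intrinsicFrontier_homogeneous_le {E : Type*} [NormedAddCommGroup E] [NormedSpace ℝ E]
    {V : Submodule ℝ E} {f : E → ℝ} (hf : Continuous f)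
    (hsmul : ∀ t : ℝ, 0 < t → ∀ v, f (t • v) = t * f v) {r : ℝ} (hr : 0 < r) {v : E} :
    v ∈ intrinsicFrontier ℝ {u | u ∈ V ∧ f u ≤ r} ↔ v ∈ V ∧ f v = r := by
  set S : Set E := {u | u ∈ V ∧ f u ≤ r}
  have hspan : affineSpan ℝ S ≤ V.toAffineSubspace := affineSpan_le.2 fun u hu => hu.1
  have hpre : ((↑) ⁻¹' S : Set (affineSpan ℝ S)) = {u : affineSpan ℝ S | f u ≤ r} :=
    Set.ext fun u => and_iff_right (hspan u.2)
  have hfc : Continuous fun u : affineSpan ℝ S => f u := hf.comp continuous_subtype_val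
  constructor
  · rintro ⟨u, hu, rfl⟩
    rw [hpre] at hu
    exact ⟨hspan u.2, frontier_le_subset_eq hfc continuous_const hu⟩
  · rintro ⟨hv, hfv⟩
    have hf0 : f 0 = 0 := by
      have := hsmul 2 two_pos 0
      rw [smul_zero] at this
      linarith
    have h0 : (0 : E) ∈ affineSpan ℝ S := subset_affineSpan ℝ S ⟨V.zero_mem, hf0.trans_le hr.le⟩
    have hvS : v ∈ affineSpan ℝ S := subset_affineSpan ℝ S ⟨hv, hfv.le⟩
    refine ⟨⟨v, hvS⟩, ⟨subset_closure ⟨hv, hfv.le⟩, fun hint => ?_⟩, rfl⟩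
    -- Moving outwards along the ray through `v` leaves the set at once.
    let ray : ℝ → affineSpan ℝ S := fun t =>
      ⟨AffineMap.lineMap 0 v t, AffineMap.lineMap_mem t h0 hvS⟩
    have hray : Continuous ray := AffineMap.lineMap_continuous.subtype_mk _
    have hray1 : ray 1 = ⟨v, hvS⟩ := Subtype.ext (AffineMap.lineMap_apply_one 0 v)
    have hnear : ∀ᶠ t in nhdsWithin (1 : ℝ) (Set.Ioi 1), f (ray t) ≤ r := by
      refine (hray.continuousAt.eventually_mem (s := {u | f u ≤ r}) ?_).filter_mono
        nhdsWithin_le_nhds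
      rwa [hray1, ← mem_interior_iff_mem_nhds, ← hpre]
    obtain ⟨t, hle, ht : 1 < t⟩ := (hnear.and self_mem_nhdsWithin).exists
    have hft : f (ray t) = t * r := by
      simp only [ray, AffineMap.lineMap_apply, vsub_eq_sub, sub_zero, vadd_eq_add, add_zero,
        hsmul t (one_pos.trans ht), hfv]
    nlinarith

lemma Arrow.point_apply {n : ℕ} (p : Arrow n) (k : Fin (n + 1)) :
    p.point k = (if k = p.head then 1 else 0) - (if k = p.tail then 1 else 0) := by
  simp [Arrow.point, Pi.single_apply]

lemma Arrow.sum_point {n : ℕ} (p : Arrow n) : ∑ k, p.point k = 0 := by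
  simp [Arrow.point_apply, sum_sub_distrib]

lemma Arrow.sum_abs_point {n : ℕ} (p : Arrow n) : ∑ k, |p.point k| = 2 := by
  have habs (k) : |p.point k| = (if k = p.head then 1 else 0) + (if k = p.tail then 1 else 0) := by
    rw [Arrow.point_apply]
    split_ifs with hh ht
    · exact absurd (ht.symm.trans hh) p.2
    all_goals norm_num
  simp only [habs, sum_add_distrib, sum_ite_eq', mem_univ, if_true]
  norm_num

lemma Arrow.point_injective {n : ℕ} : Function.Injective (Arrow.point (n := n)) := by
  have hone (p : Arrow n) (k) : p.point k = 1 ↔ p.head = k := by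
    rw [Arrow.point_apply]
    have := p.2
    grind
  have hneg (p : Arrow n) (k) : p.point k = -1 ↔ p.tail = k := by
    rw [Arrow.point_apply]
    have := p.2
    grind
  intro p q hpq
  refine Subtype.ext (Prod.ext ?_ ?_)
  · rw [← hneg p, hpq, hneg q]
  · rw [← hone p, hpq, hone q]

lemma convex_sum_eq_zero_and_sum_abs_le {ι : Type*} [Fintype ι] (r : ℝ) :
    Convex ℝ {v : ι → ℝ | ∑ k, v k = 0 ∧ ∑ k, |v k| ≤ r} := by
  rintro u ⟨hu, hu'⟩ w ⟨hw, hw'⟩ a b ha hb hab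
  refine ⟨by simp [sum_add_distrib, ← mul_sum, hu, hw], ?_⟩
  calc ∑ k, |(a • u + b • w) k| ≤ ∑ k, (a * |u k| + b * |w k|) := by
        refine sum_le_sum fun k _ => (abs_add_le _ _).trans ?_
        simp [abs_mul, abs_of_nonneg ha, abs_of_nonneg hb]
    _ = a * ∑ k, |u k| + b * ∑ k, |w k| := by simp only [sum_add_distrib, mul_sum]
    _ ≤ a * r + b * r := by gcongr
    _ = r := by rw [← add_mul, hab, one_mul]

lemma sum_arrow_eq_sum_sum {n : ℕ} {M : Type*} [AddCommMonoid M]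
    (f : Fin (n + 1) → Fin (n + 1) → M) (hf : ∀ i, f i i = 0) :
    ∑ p : Arrow n, f p.tail p.head = ∑ i, ∑ j, f i j := by
  rw [← Fintype.sum_prod_type' f]
  refine (sum_subtype (univ.filter fun q : Fin (n + 1) × Fin (n + 1) => q.1 ≠ q.2) (by simp)
    fun q => f q.1 q.2).symm.trans ?_
  rw [sum_filter]
  refine sum_congr rfl fun q _ => ite_eq_left_iff.2 fun hq => ?_
  rw [not_not.1 hq, hf]

lemma sum_posPart_sub_sum_negPart {ι : Type*} (s : Finset ι) (v : ι → ℝ) :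
    ∑ k ∈ s, (v k)⁺ - ∑ k ∈ s, (v k)⁻ = ∑ k ∈ s, v k := by
  simp only [← sum_sub_distrib, posPart_sub_negPart]

lemma sum_posPart_add_sum_negPart {ι : Type*} (s : Finset ι) (v : ι → ℝ) :
    ∑ k ∈ s, (v k)⁺ + ∑ k ∈ s, (v k)⁻ = ∑ k ∈ s, |v k| := by
  simp only [← sum_add_distrib, posPart_add_negPart]

lemma mem_rootPolytope_of_sum_abs_eq_two {n : ℕ} {v : Fin (n + 1) → ℝ} (h0 : ∑ k, v k = 0)
    (h2 : ∑ k, |v k| = 2) : v ∈ rootPolytope n := by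
  have hdiff := (sum_posPart_sub_sum_negPart univ v).trans h0
  have hsum := (sum_posPart_add_sum_negPart univ v).trans h2
  have hpos : ∑ k, (v k)⁺ = 1 := by linarith
  have hneg : ∑ k, (v k)⁻ = 1 := by linarith
  have hdisj (i) : (v i)⁻ * (v i)⁺ = 0 := by
    rcases le_total 0 (v i) with h | h
    · rw [negPart_eq_zero.2 h, zero_mul]
    · rw [posPart_eq_zero.2 h, mul_zero]
  have hw : ∑ p : Arrow n, (v p.tail)⁻ * (v p.head)⁺ = 1 := by
    rw [sum_arrow_eq_sum_sum (fun i j => (v i)⁻ * (v j)⁺) hdisj]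
    simp [← mul_sum, hpos, hneg]
  have hv : ∑ p : Arrow n, ((v p.tail)⁻ * (v p.head)⁺) • p.point = v := by
    have hdiag (i) : ((v i)⁻ * (v i)⁺) • (Pi.single i 1 - Pi.single i 1 : Fin (n + 1) → ℝ) = 0 := by
      rw [sub_self, smul_zero]
    refine (sum_arrow_eq_sum_sum (fun i j => ((v i)⁻ * (v j)⁺) •
      (Pi.single j 1 - Pi.single i 1 : Fin (n + 1) → ℝ)) hdiag).trans ?_
    funext k
    have hhead : ∑ i, ∑ j, (v i)⁻ * (v j)⁺ * (if k = j then 1 else 0) = (v k)⁺ := by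
      simp [← sum_mul, hneg]
    have htail : ∑ i, ∑ j, (v i)⁻ * (v j)⁺ * (if k = i then 1 else 0) = (v k)⁻ := by
      simp [← mul_sum, hpos]
    simp only [Finset.sum_apply, Pi.smul_apply, Pi.sub_apply, Pi.single_apply, smul_eq_mul, mul_sub,
      sum_sub_distrib, hhead, htail, posPart_sub_negPart]
  rw [← hv]
  exact (convex_convexHull ℝ _).sum_mem (fun p _ => by positivity) hw
    fun p _ => subset_convexHull ℝ _ ⟨p, rfl⟩

lemma zero_mem_rootPolytope {n : ℕ} (hn : n ≠ 0) : (0 : Fin (n + 1) → ℝ) ∈ rootPolytope n := by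
  have hne : (0 : Fin (n + 1)) ≠ Fin.last n := by simpa [Fin.ext_iff, eq_comm] using hn
  have hsum : (2⁻¹ : ℝ) • Arrow.point ⟨(0, Fin.last n), hne⟩ +
      (2⁻¹ : ℝ) • Arrow.point ⟨(Fin.last n, 0), hne.symm⟩ = 0 := by
    simp [Arrow.point, ← smul_add]
  rw [← hsum]
  exact convex_convexHull ℝ _ (subset_convexHull ℝ _ (Set.mem_range_self _))
    (subset_convexHull ℝ _ (Set.mem_range_self _)) (by norm_num) (by norm_num) (by norm_num)

lemma rootPolytope_eq {n : ℕ} (hn : n ≠ 0) :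
    rootPolytope n = {v | ∑ k, v k = 0 ∧ ∑ k, |v k| ≤ 2} := by
  refine Set.Subset.antisymm (convexHull_min ?_ (convex_sum_eq_zero_and_sum_abs_le 2)) ?_
  · rintro _ ⟨p, rfl⟩
    exact ⟨p.sum_point, p.sum_abs_point.le⟩
  rintro v ⟨h0, h2⟩
  set s := ∑ k, |v k| with hs
  have hs0 : 0 ≤ s := sum_nonneg fun k _ => abs_nonneg _
  rcases hs0.eq_or_lt with h | hpos
  · have hv : v = 0 := funext fun k => by
      simpa using (sum_eq_zero_iff_of_nonneg fun k _ => abs_nonneg (v k)).1 (hs ▸ h.symm) k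
        (mem_univ k)
    exact hv ▸ zero_mem_rootPolytope hn
  · have hmem : (2 / s) • v ∈ rootPolytope n := by
      apply mem_rootPolytope_of_sum_abs_eq_two
      · simp [← mul_sum, h0]
      · simp only [Pi.smul_apply, smul_eq_mul, abs_mul, ← mul_sum, ← hs]
        rw [abs_of_pos (by positivity), div_mul_cancel₀ _ hpos.ne']
    have := (convex_convexHull ℝ _).smul_mem_of_zero_mem (zero_mem_rootPolytope hn) hmem
      (t := s / 2) ⟨by positivity, by linarith⟩
    rwa [smul_smul, div_mul_div_cancel₀ two_ne_zero, div_self hpos.ne', one_smul] at this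

theorem mem_intrinsicFrontier_rootPolytope {n : ℕ} {v : Fin (n + 1) → ℝ} :
    v ∈ intrinsicFrontier ℝ (rootPolytope n) ↔ ∑ k, v k = 0 ∧ ∑ k, |v k| = 2 := by
  rcases eq_or_ne n 0 with rfl | hn
  · have : IsEmpty (Arrow 0) := ⟨fun p => p.2 (Subsingleton.elim (α := Fin 1) _ _)⟩
    have hempty : rootPolytope 0 = ∅ := by simp [rootPolytope, Set.range_eq_empty]
    rw [hempty, intrinsicFrontier_empty]
    simp +contextual
  · let total : (Fin (n + 1) → ℝ) →ₗ[ℝ] ℝ := ∑ k, LinearMap.proj k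
    have htotal (u) : u ∈ total.ker ↔ ∑ k, u k = 0 := by simp [total]
    have hcont : Continuous fun u : Fin (n + 1) → ℝ => ∑ k, |u k| := by fun_prop
    have hsmul (t : ℝ) (ht : 0 < t) (u : Fin (n + 1) → ℝ) :
        ∑ k, |(t • u) k| = t * ∑ k, |u k| := by
      simp [abs_mul, abs_of_pos ht, mul_sum]
    simp only [rootPolytope_eq hn, ← htotal]
    exact mem_intrinsicFrontier_homogeneous_le hcont hsmul two_pos

/-! ### The fan over a triangulation of the boundary -/

lemma weights_eq_of_mem_faces {𝕜 E : Type*} [Field 𝕜] [LinearOrder 𝕜] [IsStrictOrderedRing 𝕜]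
    [AddCommGroup E] [Module 𝕜 E] (K : Geometry.SimplicialComplex 𝕜 E) {s t : Finset E}
    (hs : s ∈ K.faces) (ht : t ∈ K.faces) {u w : E → 𝕜} (hu : ∀ x ∈ s, 0 ≤ u x)
    (hw : ∀ x ∈ t, 0 ≤ w x) (hus : ∀ x ∉ s, u x = 0) (hwt : ∀ x ∉ t, w x = 0)
    (hu1 : ∑ x ∈ s, u x = 1) (hw1 : ∑ x ∈ t, w x = 1)
    (h : ∑ x ∈ s, u x • x = ∑ x ∈ t, w x • x) : u = w := by
  classical
  have hmem : ∑ x ∈ s, u x • x ∈ convexHull 𝕜 (↑(s ∩ t) : Set E) := by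
    rw [coe_inter]
    refine K.inter_subset_convexHull hs ht ⟨?_, h ▸ ?_⟩
    · exact mem_convexHull'.2 ⟨u, hu, hu1, rfl⟩
    · exact mem_convexHull'.2 ⟨w, hw, hw1, rfl⟩
  obtain ⟨z, -, hz1, hz⟩ := mem_convexHull'.1 hmem
  have hcommon {r : Finset E} (hr : r ∈ K.faces) (hsub : s ∩ t ⊆ r) {v : E → 𝕜}
      (hvr : ∀ x ∉ r, v x = 0) (hv1 : ∑ x ∈ r, v x = 1) (hv : ∑ x ∈ r, v x • x = ∑ x ∈ s, u x • x)
      (x : E) : v x = if x ∈ s ∩ t then z x else 0 := by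
    by_cases hx : x ∈ r
    · refine (K.indep hr).eq_of_sum_eq_sum_subtype (w₂ := fun x => if x ∈ s ∩ t then z x else 0)
        ?_ ?_ x hx
      · rw [hv1, ← sum_filter, filter_mem_eq_inter, inter_eq_right.2 hsub, hz1]
      · simp only [ite_smul, zero_smul]
        rw [hv, ← sum_filter, filter_mem_eq_inter, inter_eq_right.2 hsub, hz]
    · rw [hvr x hx, if_neg fun hx' => hx (hsub hx')]
  funext x
  rw [hcommon hs inter_subset_left hus hu1 rfl, hcommon ht inter_subset_right hwt hw1 h.symm]

/-- The set of arrows with nonzero weight. -/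
noncomputable def arrowSupport {n : ℕ} {M : Type*} [Zero M] (w : Arrow n → M) : Finset (Arrow n) :=
  (Set.toFinite (Function.support w)).toFinset

/-- The cones spanned by the faces of `Δ` tile the hyperplane of vectors with zero sum. -/
def IsCompleteFan {n : ℕ} (Δ : Set (Finset (Arrow n))) : Prop :=
  ∀ v : Fin (n + 1) → ℝ, ∑ k, v k = 0 →
    ∃! w : Arrow n → ℝ, 0 ≤ w ∧ arrowSupport w ∈ Δ ∧ ∑ p, w p • p.point = v

section

variable {n : ℕ} {Δ : Set (Finset (Arrow n))}

section

variable {M : Type*} [Zero M] {w : Arrow n → M} {p : Arrow n}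

@[simp] lemma mem_arrowSupport : p ∈ arrowSupport w ↔ w p ≠ 0 := by
  simp [arrowSupport]

lemma notMem_arrowSupport : p ∉ arrowSupport w ↔ w p = 0 := by
  simp

@[simp] lemma arrowSupport_zero : arrowSupport (0 : Arrow n → M) = ∅ := by
  ext; simp

end

lemma sum_arrowSupport_smul {R M : Type*} [Semiring R] [AddCommMonoid M] [Module R M]
    (w : Arrow n → R) (f : Arrow n → M) : ∑ p ∈ arrowSupport w, w p • f p = ∑ p, w p • f p :=
  sum_subset (subset_univ _) fun p _ hp => by rw [notMem_arrowSupport.1 hp, zero_smul]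

lemma sum_arrowSupport {R : Type*} [Semiring R] (w : Arrow n → R) :
    ∑ p ∈ arrowSupport w, w p = ∑ p, w p := by
  simpa using sum_arrowSupport_smul w fun _ => (1 : R)

lemma arrowSupport_smul {R : Type*} [MulZeroClass R] [NoZeroDivisors R] {c : R} (hc : c ≠ 0)
    (w : Arrow n → R) : arrowSupport (c • w) = arrowSupport w := by
  ext; simp [hc]

lemma sum_smul_point_mem_convexHull {w : Arrow n → ℝ} (h0 : 0 ≤ w) (h1 : ∑ p, w p = 1) :
    ∑ p, w p • p.point ∈ convexHull ℝ (Arrow.point '' ↑(arrowSupport w)) := by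
  rw [← sum_arrowSupport_smul]
  exact (convex_convexHull ℝ _).sum_mem (fun p _ => h0 p) ((sum_arrowSupport w).trans h1)
    fun p hp => subset_convexHull ℝ _ ⟨p, hp, rfl⟩

lemma exists_weights_of_mem_convexHull {σ : Finset (Arrow n)} {v : Fin (n + 1) → ℝ}
    (hv : v ∈ convexHull ℝ (Arrow.point '' ↑σ)) :
    ∃ w : Arrow n → ℝ, 0 ≤ w ∧ arrowSupport w ⊆ σ ∧ ∑ p, w p • p.point = v := by
  classical
  rw [← coe_image, mem_convexHull'] at hv
  obtain ⟨u, hu0, -, huv⟩ := hv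
  rw [sum_image Arrow.point_injective.injOn] at huv
  refine ⟨fun p => if p ∈ σ then u p.point else 0, fun p => ?_, fun p hp => ?_, ?_⟩
  · dsimp only
    split_ifs with hp
    exacts [hu0 _ (mem_image_of_mem _ hp), le_rfl]
  · by_contra hpσ
    simp [hpσ] at hp
  · simpa [ite_smul] using huv

lemma arrowSupport_nonempty {w : Arrow n → ℝ} (h1 : ∑ p, w p = 1) : (arrowSupport w).Nonempty := by
  rw [nonempty_iff_ne_empty]
  intro h
  rw [← sum_arrowSupport, h, sum_empty] at h1
  exact zero_ne_one h1

namespace TriangulatesBoundary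

lemma sum_abs_sum_smul_point (hT : TriangulatesBoundary Δ) {w : Arrow n → ℝ} (h0 : 0 ≤ w)
    (hw : arrowSupport w ∈ Δ) : ∑ k, |(∑ p, w p • p.point) k| = 2 * ∑ p, w p := by
  classical
  wlog h1 : ∑ p, w p = 1 generalizing w
  · rcases (sum_nonneg fun p _ => h0 p : 0 ≤ ∑ p, w p).eq_or_lt with hsum | hsum
    · have hz : w = 0 := funext fun p =>
        (sum_eq_zero_iff_of_nonneg fun p _ => h0 p).1 hsum.symm p (mem_univ p)
      simp [hz]
    · have := this (smul_nonneg (inv_nonneg.2 hsum.le) h0)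
        (by rwa [arrowSupport_smul (inv_ne_zero hsum.ne')])
        (by simp [← mul_sum, inv_mul_cancel₀ hsum.ne'])
      simp only [Pi.smul_apply, smul_eq_mul, ← smul_smul, ← smul_sum, ← mul_sum, abs_mul,
        abs_of_pos (inv_pos.2 hsum)] at this
      field_simp at this
      linarith
  obtain ⟨K, hK, hsp⟩ := hT
  have hface : (arrowSupport w).image Arrow.point ∈ K.faces := by
    rw [hK]
    exact ⟨_, hw, arrowSupport_nonempty h1, coe_image⟩
  have hmem := K.convexHull_subset_space hface
    (by rw [coe_image]; exact sum_smul_point_mem_convexHull h0 h1)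
  rw [hsp, mem_intrinsicFrontier_rootPolytope] at hmem
  rw [hmem.2, h1, mul_one]

lemma weights_eq_of_sum_eq_one (hT : TriangulatesBoundary Δ) {u w : Arrow n → ℝ} (hu0 : 0 ≤ u)
    (hw0 : 0 ≤ w) (hu : arrowSupport u ∈ Δ) (hw : arrowSupport w ∈ Δ) (hu1 : ∑ p, u p = 1)
    (hw1 : ∑ p, w p = 1) (h : ∑ p, u p • p.point = ∑ p, w p • p.point) : u = w := by
  classical
  obtain ⟨K, hK, -⟩ := hT
  have hface {y : Arrow n → ℝ} (hy : arrowSupport y ∈ Δ) (hy1 : ∑ p, y p = 1) :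
      (arrowSupport y).image Arrow.point ∈ K.faces := by
    rw [hK]
    exact ⟨_, hy, arrowSupport_nonempty hy1, coe_image⟩
  have hinj := Arrow.point_injective (n := n)
  let ext (y : Arrow n → ℝ) := Function.extend Arrow.point y 0
  have hext (y) (p : Arrow n) : ext y p.point = y p := hinj.extend_apply y 0 p
  have hext0 (y : Arrow n → ℝ) (hy : 0 ≤ y) : ∀ x ∈ (arrowSupport y).image Arrow.point,
      0 ≤ ext y x := by
    refine forall_mem_image.2 fun p _ => ?_
    rw [hext]
    exact hy p
  have hextout (y : Arrow n → ℝ) : ∀ x ∉ (arrowSupport y).image Arrow.point, ext y x = 0 := by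
    intro x hx
    by_cases hxp : ∃ p : Arrow n, p.point = x
    · obtain ⟨p, rfl⟩ := hxp
      rw [hext, ← notMem_arrowSupport]
      exact fun hp => hx (mem_image_of_mem _ hp)
    · exact Function.extend_apply' _ _ _ hxp
  have huw : ext u = ext w := by
    refine weights_eq_of_mem_faces K (hface hu hu1) (hface hw hw1) (hext0 u hu0) (hext0 w hw0)
      (hextout u) (hextout w) ?_ ?_ ?_ <;>
    simpa only [sum_image hinj.injOn, hext, sum_arrowSupport, sum_arrowSupport_smul]
  funext p
  rw [← hext u, huw, hext]

lemma exists_weights (hC : IsSimplicialComplex Δ) (hT : TriangulatesBoundary Δ)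
    {v : Fin (n + 1) → ℝ} (hv : ∑ k, v k = 0) :
    ∃ w : Arrow n → ℝ, 0 ≤ w ∧ arrowSupport w ∈ Δ ∧ ∑ p, w p • p.point = v := by
  by_cases hv0 : v = 0
  · exact ⟨0, le_rfl, by simpa using hC.empty_mem, by simp [hv0]⟩
  obtain ⟨j, hj⟩ := Function.ne_iff.1 hv0
  set s := ∑ k, |v k| with hs
  have hpos : 0 < s := sum_pos' (fun k _ => abs_nonneg _) ⟨j, mem_univ j, abs_pos.2 hj⟩
  have hbd : (2 / s) • v ∈ intrinsicFrontier ℝ (rootPolytope n) := by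
    rw [mem_intrinsicFrontier_rootPolytope]
    refine ⟨by simp [← mul_sum, hv], ?_⟩
    simp only [Pi.smul_apply, smul_eq_mul, abs_mul, ← mul_sum, ← hs]
    rw [abs_of_pos (by positivity), div_mul_cancel₀ _ hpos.ne']
  obtain ⟨K, hK, hsp⟩ := hT
  rw [← hsp, Geometry.SimplicialComplex.mem_space_iff] at hbd
  obtain ⟨t, ht, hvt⟩ := hbd
  rw [hK] at ht
  obtain ⟨σ, hσ, -, htσ⟩ := ht
  rw [htσ] at hvt
  obtain ⟨w, hw0, hwσ, hw⟩ := exists_weights_of_mem_convexHull hvt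
  refine ⟨(s / 2) • w, smul_nonneg (by positivity) hw0, ?_, ?_⟩
  · rw [arrowSupport_smul (by positivity)]
    exact hC.down_closed σ hσ _ hwσ
  · simp only [Pi.smul_apply, smul_assoc, ← smul_sum, hw]
    rw [smul_smul, div_mul_div_cancel₀ two_ne_zero, div_self hpos.ne', one_smul]

lemma weights_unique (hT : TriangulatesBoundary Δ) {u w : Arrow n → ℝ} (hu0 : 0 ≤ u) (hw0 : 0 ≤ w)
    (hu : arrowSupport u ∈ Δ) (hw : arrowSupport w ∈ Δ)
    (h : ∑ p, u p • p.point = ∑ p, w p • p.point) : u = w := by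
  have htotal : ∑ p, u p = ∑ p, w p := by
    refine mul_left_cancel₀ two_ne_zero ?_
    rw [← hT.sum_abs_sum_smul_point hu0 hu, ← hT.sum_abs_sum_smul_point hw0 hw, h]
  rcases eq_or_ne (∑ p, w p) 0 with hzero | hne
  · have hall {y : Arrow n → ℝ} (hy0 : 0 ≤ y) (hy : ∑ p, y p = 0) : y = 0 := funext fun p =>
      (sum_eq_zero_iff_of_nonneg fun p _ => hy0 p).1 hy p (mem_univ p)
    rw [hall hu0 (htotal.trans hzero), hall hw0 hzero]
  · have hc : 0 ≤ (∑ p, w p)⁻¹ := inv_nonneg.2 (sum_nonneg fun p _ => hw0 p)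
    refine smul_right_injective _ (inv_ne_zero hne) (hT.weights_eq_of_sum_eq_one
      (smul_nonneg hc hu0) (smul_nonneg hc hw0) ?_ ?_ ?_ ?_ ?_)
    · rwa [arrowSupport_smul (inv_ne_zero hne)]
    · rwa [arrowSupport_smul (inv_ne_zero hne)]
    · simp [← mul_sum, htotal, inv_mul_cancel₀ hne]
    · simp [← mul_sum, inv_mul_cancel₀ hne]
    · simp only [Pi.smul_apply, smul_assoc, ← smul_sum, h]

theorem isCompleteFan (hC : IsSimplicialComplex Δ) (hT : TriangulatesBoundary Δ) :
    IsCompleteFan Δ := by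
  intro v hv
  obtain ⟨w, hw0, hw, hwv⟩ := hT.exists_weights hC hv
  exact ⟨w, ⟨hw0, hw, hwv⟩, fun u ⟨hu0, hu, huv⟩ =>
    hT.weights_unique hu0 hw0 hu hw (huv.trans hwv.symm)⟩

end TriangulatesBoundary

end

/-! ### Unimodularity -/

/-- The number of arrows with tail `k` in the multiset `m`. -/
def outDegree {n : ℕ} (m : Arrow n → ℕ) (k : Fin (n + 1)) : ℕ := ∑ p with p.tail = k, m p

/-- The number of arrows with head `k` in the multiset `m`. -/
def inDegree {n : ℕ} (m : Arrow n → ℕ) (k : Fin (n + 1)) : ℕ := ∑ p with p.head = k, m p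

/-- The excess of tails over heads at the node `k`: minus the `k`-th coordinate of the sum of the
points represented by the multiset `m`. -/
def divergence {n : ℕ} (m : Arrow n → ℕ) (k : Fin (n + 1)) : ℤ := outDegree m k - inDegree m k

/-- Every integer vector with zero sum is the divergence of exactly one multiset of arrows that is
supported on a face of `Δ`. -/
def IsUnimodular {n : ℕ} (Δ : Set (Finset (Arrow n))) : Prop :=
  ∀ d : Fin (n + 1) → ℤ, ∑ k, d k = 0 →
    ∃! m : Arrow n → ℕ, arrowSupport m ∈ Δ ∧ divergence m = d

section

variable {n : ℕ}

lemma IsCompleteFan.linearIndepOn {Δ : Set (Finset (Arrow n))} (hF : IsCompleteFan Δ)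
    (hC : IsSimplicialComplex Δ) {σ : Finset (Arrow n)} (hσ : σ ∈ Δ) :
    LinearIndepOn ℝ Arrow.point (σ : Set (Arrow n)) := by
  classical
  refine linearIndepOn_finset_iff.2 fun f hf p hp => ?_
  set g : Arrow n → ℝ := fun q => if q ∈ σ then f q else 0 with hg
  have hzero : ∑ q, (g q)⁺ • q.point = ∑ q, (g q)⁻ • q.point := by
    rw [← sub_eq_zero, ← sum_sub_distrib]
    simpa only [← sub_smul, posPart_sub_negPart, hg, ite_smul, zero_smul, sum_ite_mem,
      univ_inter] using hf
  have hface {w : Arrow n → ℝ} (hw : ∀ q, g q = 0 → w q = 0) : arrowSupport w ∈ Δ :=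
    hC.down_closed σ hσ _ fun q hq => by
      by_contra hqσ
      exact mem_arrowSupport.1 hq (hw q (if_neg hqσ))
  have hsum : ∑ k, (∑ q, (g q)⁺ • q.point) k = 0 := by
    simp only [Finset.sum_apply, Pi.smul_apply, smul_eq_mul]
    rw [sum_comm]
    simp only [← mul_sum, Arrow.sum_point, mul_zero, sum_const_zero]
  have heq : (fun q => (g q)⁺) = fun q => (g q)⁻ := (hF _ hsum).unique
    ⟨fun q => posPart_nonneg _, hface fun q hq => by simp [hq], rfl⟩
    ⟨fun q => negPart_nonneg _, hface fun q hq => by simp [hq], hzero.symm⟩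
  calc f p = g p := by simp [hg, hp]
    _ = (g p)⁺ - (g p)⁻ := (posPart_sub_negPart _).symm
    _ = 0 := sub_eq_zero.2 (congrFun heq p)

lemma card_lt_card_of_linearIndepOn {τ : Finset (Arrow n)}
    (hτ : LinearIndepOn ℝ Arrow.point (τ : Set (Arrow n))) {V : Finset (Fin (n + 1))}
    (hV : V.Nonempty) (hmem : ∀ p ∈ τ, p.tail ∈ V ∧ p.head ∈ V) : #τ < #V := by
  classical
  obtain ⟨k, hk⟩ := hV
  set b : Fin (n + 1) → Fin (n + 1) → ℝ := fun j => Pi.single j 1 - Pi.single k 1 with hb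
  set B := (V.erase k).image b
  have hspan {j : Fin (n + 1)} (hj : j ∈ V) : b j ∈ Submodule.span ℝ (B : Set _) := by
    by_cases hjk : j = k
    · simp [hb, hjk]
    · exact Submodule.subset_span (mem_image_of_mem b (mem_erase.2 ⟨hjk, hj⟩))
  have hrange : Set.range (fun p : (τ : Set (Arrow n)) => p.1.point) ⊆
      Submodule.span ℝ (B : Set (Fin (n + 1) → ℝ)) := by
    rintro _ ⟨p, rfl⟩
    have hp : p.1.point = b p.1.head - b p.1.tail := (sub_sub_sub_cancel_right _ _ _).symm
    change p.1.point ∈ Submodule.span ℝ (B : Set (Fin (n + 1) → ℝ))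
    rw [hp]
    exact Submodule.sub_mem _ (hspan (hmem p.1 p.2).2) (hspan (hmem p.1 p.2).1)
  have hle : #τ ≤ #B := by
    simpa using linearIndependent_le_span' _ hτ (B : Set (Fin (n + 1) → ℝ)) hrange
  exact (hle.trans card_image_le).trans_lt (card_erase_lt_of_mem hk)

lemma Arrow.point_eq_zero {p : Arrow n} {k : Fin (n + 1)} (hk : ¬(p.tail = k ∨ p.head = k)) :
    p.point k = 0 := by
  rw [not_or] at hk
  rw [p.point_apply, if_neg (Ne.symm hk.1), if_neg (Ne.symm hk.2), sub_zero]

lemma Arrow.point_eq_one_or_neg_one {p : Arrow n} {k : Fin (n + 1)}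
    (hk : p.tail = k ∨ p.head = k) : p.point k = 1 ∨ p.point k = -1 := by
  have hp : p.tail ≠ p.head := p.2
  rw [p.point_apply]
  rcases hk with rfl | rfl
  · simp [hp]
  · simp [hp.symm]

lemma exists_ne_notMem_of_sum_smul_point_mem (R : Subring ℝ) {w : Arrow n → ℝ} {k : Fin (n + 1)}
    (hk : (∑ p, w p • p.point) k ∈ R) {p : Arrow n} (hp : w p ∉ R)
    (hpk : p.tail = k ∨ p.head = k) : ∃ q ≠ p, w q ∉ R ∧ (q.tail = k ∨ q.head = k) := by
  by_contra! hall
  have hrest : ∑ q ∈ univ.erase p, w q * q.point k ∈ R := by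
    refine R.sum_mem fun q hq => ?_
    by_cases hqk : q.tail = k ∨ q.head = k
    · have hwq : w q ∈ R := by
        by_contra hwq
        exact hqk.elim (hall q (ne_of_mem_erase hq) hwq).1 (hall q (ne_of_mem_erase hq) hwq).2
      rcases Arrow.point_eq_one_or_neg_one hqk with h | h <;> simpa [h] using hwq
    · simp [Arrow.point_eq_zero hqk]
  simp only [Finset.sum_apply, Pi.smul_apply, smul_eq_mul] at hk
  rw [← add_sum_erase univ _ (mem_univ p), add_mem_cancel_right hrest] at hk
  rcases Arrow.point_eq_one_or_neg_one hpk with h | h <;> exact hp (by simpa [h] using hk)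

lemma mem_of_forall_sum_smul_point_mem (R : Subring ℝ) {w : Arrow n → ℝ}
    (hw : LinearIndepOn ℝ Arrow.point (arrowSupport w : Set (Arrow n)))
    (hR : ∀ k, (∑ p, w p • p.point) k ∈ R) (p : Arrow n) : w p ∈ R := by
  classical
  by_contra hp
  set τ : Finset (Arrow n) := {q | w q ∉ R} with hτ
  set V : Finset (Fin (n + 1)) := {k | ∃ q ∈ τ, q.tail = k ∨ q.head = k} with hV
  have hsub : (τ : Set (Arrow n)) ⊆ arrowSupport w := fun q hq => by
    exact mem_arrowSupport.2 fun h0 => (mem_filter.1 hq).2 (h0 ▸ R.zero_mem)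
  have hends (q) (hq : q ∈ τ) : q.tail ∈ V ∧ q.head ∈ V := by
    simp only [hV, mem_filter, mem_univ, true_and]
    exact ⟨⟨q, hq, .inl rfl⟩, ⟨q, hq, .inr rfl⟩⟩
  have hlt : #τ < #V := card_lt_card_of_linearIndepOn (hw.mono hsub)
    ⟨p.tail, (hends p (by simpa [hτ] using hp)).1⟩ hends
  have hle : #V * 2 ≤ #τ * 2 := by
    refine card_mul_le_card_mul (fun k (q : Arrow n) => q.tail = k ∨ q.head = k) ?_ ?_
    · intro k hk
      obtain ⟨q, hq, hqk⟩ := (mem_filter.1 hk).2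
      obtain ⟨r, hne, hr, hrk⟩ :=
        exists_ne_notMem_of_sum_smul_point_mem R (hR k) (by simpa [hτ] using hq) hqk
      refine one_lt_card.2 ⟨r, ?_, q, ?_, hne⟩
      · simpa [bipartiteAbove, hτ, hrk] using hr
      · simpa [bipartiteAbove, hqk] using hq
    · refine fun q _ => (card_le_card (t := {q.tail, q.head}) fun k hk => ?_).trans card_le_two
      simpa [eq_comm] using (mem_filter.1 hk).2
  lia

lemma sum_divergence_eq (m : Arrow n → ℕ) (S : Finset (Fin (n + 1))) :
    ∑ k ∈ S, divergence m k =
      ((∑ p with p.tail ∈ S, m p : ℕ) : ℤ) - (∑ p with p.head ∈ S, m p : ℕ) := by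
  simp only [divergence, outDegree, inDegree, sum_sub_distrib, ← Nat.cast_sum,
    sum_fiberwise_eq_sum_filter]

lemma sum_divergence (m : Arrow n → ℕ) : ∑ k, divergence m k = 0 := by
  simp [sum_divergence_eq]

lemma sum_natCast_smul_point (m : Arrow n → ℕ) :
    ∑ p, (m p : ℝ) • p.point = fun k => -(divergence m k : ℝ) := by
  funext k
  simp [divergence, outDegree, inDegree, Arrow.point_apply, mul_sub, sum_filter, eq_comm (a := k)]

lemma arrowSupport_natCast (m : Arrow n → ℕ) :
    arrowSupport (fun p => (m p : ℝ)) = arrowSupport m := by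
  ext; simp

theorem IsCompleteFan.isUnimodular {Δ : Set (Finset (Arrow n))} (hF : IsCompleteFan Δ)
    (hC : IsSimplicialComplex Δ) : IsUnimodular Δ := by
  intro d hd
  obtain ⟨w, ⟨hw0, hw, hwd⟩, huniq⟩ := hF (fun k => -(d k : ℝ)) (by simp [← Int.cast_sum, hd])
  have hint (p) : w p ∈ (Int.castRingHom ℝ).range :=
    mem_of_forall_sum_smul_point_mem _ (hF.linearIndepOn hC hw)
      (fun k => hwd ▸ ⟨-d k, by simp⟩) p
  have hnat (p) : ∃ m : ℕ, (m : ℝ) = w p := by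
    obtain ⟨z, hz : (z : ℝ) = w p⟩ := hint p
    have hz0 : (0 : ℝ) ≤ z := (hw0 p).trans_eq hz.symm
    lift z to ℕ using Int.cast_nonneg_iff.1 hz0
    exact ⟨z, by exact_mod_cast hz⟩
  choose m hm using hnat
  obtain rfl : (fun p => (m p : ℝ)) = w := funext hm
  refine ⟨m, ⟨arrowSupport_natCast m ▸ hw, ?_⟩, fun m' ⟨hm', hd'⟩ => ?_⟩
  · rw [sum_natCast_smul_point] at hwd
    funext k
    exact_mod_cast neg_injective (congrFun hwd k)
  · have heq := huniq (fun p => (m' p : ℝ)) ⟨fun p => Nat.cast_nonneg _,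
      (arrowSupport_natCast m').symm ▸ hm', by rw [sum_natCast_smul_point, hd']⟩
    funext p
    exact_mod_cast congrFun heq p

end

/-! ### Faces of unimodular complexes -/

section

variable {n : ℕ}

lemma divergence_add (m m' : Arrow n → ℕ) : divergence (m + m') = divergence m + divergence m' := by
  funext k
  simp only [divergence, outDegree, inDegree, Pi.add_apply, sum_add_distrib, Nat.cast_add]
  ring

lemma divergence_single (p : Arrow n) :
    divergence (Pi.single p 1) = Pi.single p.tail 1 - Pi.single p.head 1 := by
  funext k
  simp [divergence, outDegree, inDegree, Pi.single_apply, eq_comm (a := k)]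

lemma arrowSupport_single (p : Arrow n) : arrowSupport (Pi.single p 1 : Arrow n → ℕ) = {p} := by
  ext; simp [Pi.single_apply]

lemma arrowSupport_single_add_single (p q : Arrow n) :
    arrowSupport (Pi.single p 1 + Pi.single q 1 : Arrow n → ℕ) = {p, q} := by
  ext r
  simp only [mem_arrowSupport, Pi.add_apply, Pi.single_apply, mem_insert, mem_singleton]
  split_ifs <;> simp [*]

variable {Δ : Set (Finset (Arrow n))}

lemma IsSimplicialComplex.pair_mem (hC : IsSimplicialComplex Δ) {σ : Finset (Arrow n)}
    (hσ : σ ∈ Δ) {p q : Arrow n} (hp : p ∈ σ) (hq : q ∈ σ) : {p, q} ∈ Δ :=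
  hC.down_closed σ hσ _ (by simp [insert_subset_iff, hp, hq])

namespace IsUnimodular

lemma eq_of_divergence_eq (hU : IsUnimodular Δ) {m m' : Arrow n → ℕ} (hm : arrowSupport m ∈ Δ)
    (hm' : arrowSupport m' ∈ Δ) (h : divergence m = divergence m') : m = m' :=
  (hU _ (sum_divergence m')).unique ⟨hm, h⟩ ⟨hm', rfl⟩

lemma tail_ne_head (hU : IsUnimodular Δ) (hC : IsSimplicialComplex Δ) {σ : Finset (Arrow n)}
    (hσ : σ ∈ Δ) {p q : Arrow n} (hp : p ∈ σ) (hq : q ∈ σ) : p.tail ≠ q.head := by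
  intro hpq
  have hpair : arrowSupport (Pi.single p 1 + Pi.single q 1 : Arrow n → ℕ) ∈ Δ :=
    arrowSupport_single_add_single p q ▸ hC.pair_mem hσ hp hq
  have hdiv : divergence (Pi.single p 1 + Pi.single q 1) =
      Pi.single q.tail 1 - Pi.single p.head 1 := by
    rw [divergence_add, divergence_single, divergence_single, hpq]
    abel
  by_cases hloop : q.tail = p.head
  · have h0 := hU.eq_of_divergence_eq hpair (m' := 0) (by simpa using hC.empty_mem)
      (by rw [hdiv, hloop, sub_self]; ext; simp [divergence, outDegree, inDegree])
    simpa using congrFun h0 p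
  · have h1 := hU.eq_of_divergence_eq hpair (m' := Pi.single ⟨(q.tail, p.head), hloop⟩ 1)
      (by rw [arrowSupport_single]; exact hC.singleton_mem _) (by rw [hdiv, divergence_single])
    have htotal := congrArg (fun m : Arrow n → ℕ => ∑ r, m r) h1
    simp [sum_add_distrib] at htotal

lemma exchange_notMem (hU : IsUnimodular Δ) {p q : Arrow n} (ht : p.tail ≠ q.tail)
    (hh : p.head ≠ q.head) (hpq : p.tail ≠ q.head) (hqp : q.tail ≠ p.head) (h : {p, q} ∈ Δ) :
    ({⟨(p.tail, q.head), hpq⟩, ⟨(q.tail, p.head), hqp⟩} : Finset (Arrow n)) ∉ Δ := by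
  intro h'
  rw [← arrowSupport_single_add_single] at h h'
  have heq := hU.eq_of_divergence_eq h h' (by simp only [divergence_add, divergence_single]; abel)
  have hmem : p ∈ ({⟨(p.tail, q.head), hpq⟩, ⟨(q.tail, p.head), hqp⟩} : Finset (Arrow n)) := by
    rw [← arrowSupport_single_add_single, ← heq, arrowSupport_single_add_single]
    exact mem_insert_self _ _
  rw [mem_insert, mem_singleton] at hmem
  rcases hmem with hp | hp
  · exact hh (Prod.ext_iff.1 (Subtype.ext_iff.1 hp)).2
  · exact ht (Prod.ext_iff.1 (Subtype.ext_iff.1 hp)).1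

variable {m : Arrow n → ℕ}

lemma outDegree_eq_zero_or_inDegree_eq_zero (hU : IsUnimodular Δ) (hC : IsSimplicialComplex Δ)
    (hm : arrowSupport m ∈ Δ) (k : Fin (n + 1)) : outDegree m k = 0 ∨ inDegree m k = 0 := by
  by_contra! hne
  obtain ⟨p, hp, hmp⟩ := exists_ne_zero_of_sum_ne_zero hne.1
  obtain ⟨q, hq, hmq⟩ := exists_ne_zero_of_sum_ne_zero hne.2
  exact hU.tail_ne_head hC hm (mem_arrowSupport.2 hmp) (mem_arrowSupport.2 hmq)
    ((mem_filter.1 hp).2.trans (mem_filter.1 hq).2.symm)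

lemma toNat_divergence (hU : IsUnimodular Δ) (hC : IsSimplicialComplex Δ)
    (hm : arrowSupport m ∈ Δ) (k : Fin (n + 1)) : (divergence m k).toNat = outDegree m k := by
  rw [divergence]
  rcases hU.outDegree_eq_zero_or_inDegree_eq_zero hC hm k with h | h <;> simp [h]

lemma divergence_ne_zero_iff (hU : IsUnimodular Δ) (hC : IsSimplicialComplex Δ)
    (hm : arrowSupport m ∈ Δ) (k : Fin (n + 1)) :
    divergence m k ≠ 0 ↔ ∃ p ∈ arrowSupport m, p.tail = k ∨ p.head = k := by
  have hdeg : divergence m k = 0 ↔ outDegree m k = 0 ∧ inDegree m k = 0 := by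
    rw [divergence]
    have := hU.outDegree_eq_zero_or_inDegree_eq_zero hC hm k
    lia
  rw [Ne, hdeg, outDegree, inDegree, sum_eq_zero_iff, sum_eq_zero_iff]
  simp only [mem_filter, mem_univ, true_and, mem_arrowSupport]
  grind

end IsUnimodular

end

/-! ### Cuts -/

/-- The cut in front of the node `k` is crossed by every forward arrow of `σ` and by no backward
arrow of `σ`. -/
def IsCut {n : ℕ} (σ : Finset (Arrow n)) (k : ℕ) : Prop :=
  (∀ p ∈ σ, p.tail < p.head → p.tail.val < k ∧ k ≤ p.head.val) ∧
    ∀ p ∈ σ, p.head < p.tail → ¬(p.head.val < k ∧ k ≤ p.tail.val)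

section

variable {n : ℕ} {σ : Finset (Arrow n)}

lemma exists_last_tail_first_head (hne : ∀ p ∈ σ, ∀ q ∈ σ, p.tail ≠ q.head)
    (hdisj : ∀ p ∈ σ, ∀ q ∈ σ, ¬(p.tail < p.head ∧ p.head < q.tail ∧ q.tail < q.head))
    (hfw : ∃ p ∈ σ, p.tail < p.head) :
    ∃ a ∈ σ, ∃ b ∈ σ, a.tail < a.head ∧ b.tail < b.head ∧ a.tail < b.head ∧
      ∀ p ∈ σ, p.tail < p.head → p.tail ≤ a.tail ∧ b.head ≤ p.head := by
  have hfw' : {p ∈ σ | p.tail < p.head}.Nonempty := by simpa [Finset.Nonempty] using hfw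
  obtain ⟨a, ha, hmax⟩ := exists_max_image _ (fun p : Arrow n => p.tail) hfw'
  obtain ⟨b, hb, hmin⟩ := exists_min_image _ (fun p : Arrow n => p.head) hfw'
  simp only [mem_filter] at ha hb hmax hmin
  refine ⟨a, ha.1, b, hb.1, ha.2, hb.2, ?_, fun p hp hlt => ⟨hmax p ⟨hp, hlt⟩, hmin p ⟨hp, hlt⟩⟩⟩
  refine (lt_or_gt_of_ne (hne a ha.1 b hb.1)).resolve_right fun hlt => ?_
  exact hdisj b hb.1 a ha.1 ⟨hb.2, hlt, ha.2⟩

lemma exists_uncrossed_of_nest (hne : ∀ p ∈ σ, ∀ q ∈ σ, p.tail ≠ q.head)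
    (hTTHH : ∀ p ∈ σ, ∀ q ∈ σ, ¬(p.tail < q.tail ∧ q.tail < p.head ∧ p.head < q.head))
    (hHHTT : ∀ p ∈ σ, ∀ q ∈ σ, ¬(p.head < q.head ∧ q.head < p.tail ∧ p.tail < q.tail))
    {a b : Arrow n} (ha : a ∈ σ) (hb : b ∈ σ) (hab : a.tail < b.head)
    (hover : ∀ p ∈ σ, p.head < a.tail → p.tail < a.head)
    (hunder : ∀ p ∈ σ, b.head < p.tail → b.tail < p.head) :
    ∃ k : ℕ, a.tail.val < k ∧ k ≤ b.head.val ∧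
      ∀ p ∈ σ, p.head < p.tail → ¬(p.head.val < k ∧ k ≤ p.tail.val) := by
  by_cases hcov : ∃ p ∈ σ, p.head < a.tail ∧ a.tail < p.tail
  · have hcov' : {p ∈ σ | p.head < a.tail ∧ a.tail < p.tail}.Nonempty := by
      simpa [Finset.Nonempty] using hcov
    obtain ⟨p, hp, hpmax⟩ := exists_max_image _ (fun p : Arrow n => p.tail) hcov'
    simp only [mem_filter] at hp hpmax
    have hpa := hover p hp.1 hp.2.1
    have hpb : p.tail < b.head := by
      refine (lt_or_gt_of_ne (hne p hp.1 b hb)).resolve_right fun hlt => ?_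
      have hbp := hunder p hp.1 hlt
      exact hTTHH b hb a ha ⟨hbp.trans hp.2.1, hab, hlt.trans hpa⟩
    refine ⟨p.tail + 1, by omega, hpb, fun q hq _ hk => ?_⟩
    have hqp := hne p hp.1 q hq
    have hnest := hHHTT p hp.1 q hq
    have hmax := hpmax q
    grind
  · refine ⟨a.tail + 1, Nat.lt_succ_self _, hab, fun p hp _ hk => hcov ⟨p, hp, ?_⟩⟩
    have := hne a ha p hp
    omega

theorem exists_isCut (hne : ∀ p ∈ σ, ∀ q ∈ σ, p.tail ≠ q.head)
    (hdisj : ∀ p ∈ σ, ∀ q ∈ σ, ¬(p.tail < p.head ∧ p.head < q.tail ∧ q.tail < q.head))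
    (hnest : ∀ p ∈ σ, ∀ q ∈ σ, ¬(p.head < q.tail ∧ q.tail < q.head ∧ q.head < p.tail))
    (hcross : (∀ p ∈ σ, ∀ q ∈ σ, ¬(p.tail < q.head ∧ q.head < p.head ∧ p.head < q.tail)) ∨
      (∀ p ∈ σ, ∀ q ∈ σ, ¬(p.head < q.tail ∧ q.tail < p.tail ∧ p.tail < q.head)) ∨
      ((∀ p ∈ σ, ∀ q ∈ σ, ¬(p.tail < q.tail ∧ q.tail < p.head ∧ p.head < q.head)) ∧
        ∀ p ∈ σ, ∀ q ∈ σ, ¬(p.head < q.head ∧ q.head < p.tail ∧ p.tail < q.tail))) :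
    ∃ k, IsCut σ k := by
  by_cases hfw : ∃ p ∈ σ, p.tail < p.head
  swap
  · exact ⟨0, fun p hp hlt => absurd ⟨p, hp, hlt⟩ hfw, fun p _ _ hk => Nat.not_lt_zero _ hk.1⟩
  obtain ⟨a, ha, b, hb, haf, hbf, hab, hext⟩ := exists_last_tail_first_head hne hdisj hfw
  have hforward {k : ℕ} (hak : a.tail.val < k) (hkb : k ≤ b.head.val) (p) (hp : p ∈ σ)
      (hlt : p.tail < p.head) : p.tail.val < k ∧ k ≤ p.head.val :=
    ⟨(Fin.le_def.1 (hext p hp hlt).1).trans_lt hak, hkb.trans (hext p hp hlt).2⟩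
  have hover {p} (hp : p ∈ σ) (hpa : p.head < a.tail) : p.tail < a.head := by
    have := hnest p hp a ha
    have := hne p hp a ha
    grind
  have hunder {p} (hp : p ∈ σ) (hbp : b.head < p.tail) : b.tail < p.head := by
    have := hnest p hp b hb
    have := hne b hb p hp
    grind
  rcases hcross with hc | hc | ⟨hc1, hc2⟩
  · refine ⟨b.head, hforward hab le_rfl, fun p hp _ hk => ?_⟩
    have := hne p hp b hb
    have := hunder hp (by omega)
    have := hc b hb p hp
    omega
  · refine ⟨a.tail + 1, hforward (Nat.lt_succ_self _) hab, fun p hp _ hk => ?_⟩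
    have := hne a ha p hp
    have := hover hp (by omega)
    have := hc p hp a ha
    omega
  · obtain ⟨k, hak, hkb, hk⟩ :=
      exists_uncrossed_of_nest hne hc1 hc2 ha hb hab (fun _ => hover) fun _ => hunder
    exact ⟨k, hforward hak hkb, hk⟩

end

section

variable {F : Collection} {n : ℕ} {p q : Arrow n}

namespace IsUniform

lemma pair_mem (hF : IsUniform F) (hpq : {p, q} ∈ F n) {m : ℕ} {p' q' : Arrow m}
    {π : Fin 4 → Fin 4} (hπ : π.Surjective) (h : StrictMono (nodes p q ∘ π))
    (h' : StrictMono (nodes p' q' ∘ π)) : {p', q'} ∈ F m := by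
  refine (hF _ _ _ _ _ _ fun s t => ?_).1 hpq
  obtain ⟨i, rfl⟩ := hπ s
  obtain ⟨j, rfl⟩ := hπ t
  exact h.lt_iff_lt.trans h'.lt_iff_lt.symm

lemma notMem_of_not_HTHTNest (hF : IsUniform F) (h : ¬HTHTNest F) (h₁ : p.head < q.tail)
    (h₂ : q.tail < q.head) (h₃ : q.head < p.tail) : {p, q} ∉ F n := by
  simp only [HTHTNest, not_forall] at h
  obtain ⟨m, p', q', h₁', h₂', h₃', hnot⟩ := h
  exact fun hpq => hnot <| hF.pair_mem hpq (π := ![1, 2, 3, 0]) (by decide)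
    (Fin.strictMono_iff_lt_succ.2 fun | 0 => h₁ | 1 => h₂ | 2 => h₃)
    (Fin.strictMono_iff_lt_succ.2 fun | 0 => h₁' | 1 => h₂' | 2 => h₃')

lemma notMem_of_not_THHTCross (hF : IsUniform F) (h : ¬THHTCross F) (h₁ : p.tail < q.head)
    (h₂ : q.head < p.head) (h₃ : p.head < q.tail) : {p, q} ∉ F n := by
  simp only [THHTCross, not_forall] at h
  obtain ⟨m, p', q', h₁', h₂', h₃', hnot⟩ := h
  exact fun hpq => hnot <| hF.pair_mem hpq (π := ![0, 3, 1, 2]) (by decide)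
    (Fin.strictMono_iff_lt_succ.2 fun | 0 => h₁ | 1 => h₂ | 2 => h₃)
    (Fin.strictMono_iff_lt_succ.2 fun | 0 => h₁' | 1 => h₂' | 2 => h₃')

lemma notMem_of_not_HTTHCross (hF : IsUniform F) (h : ¬HTTHCross F) (h₁ : p.head < q.tail)
    (h₂ : q.tail < p.tail) (h₃ : p.tail < q.head) : {p, q} ∉ F n := by
  simp only [HTTHCross, not_forall] at h
  obtain ⟨m, p', q', h₁', h₂', h₃', hnot⟩ := h
  exact fun hpq => hnot <| hF.pair_mem hpq (π := ![1, 2, 0, 3]) (by decide)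
    (Fin.strictMono_iff_lt_succ.2 fun | 0 => h₁ | 1 => h₂ | 2 => h₃)
    (Fin.strictMono_iff_lt_succ.2 fun | 0 => h₁' | 1 => h₂' | 2 => h₃')

end IsUniform

lemma THTHNest.disjoint_notMem (h : THTHNest F) (hU : IsUnimodular (F n)) (h₁ : p.tail < p.head)
    (h₂ : p.head < q.tail) (h₃ : q.tail < q.head) : {p, q} ∉ F n := fun hmem =>
  hU.exchange_notMem (h₁.trans h₂).ne (h₂.trans h₃).ne (h₁.trans (h₂.trans h₃)).ne h₂.ne' hmem
    (h n _ _ h₁ h₂ h₃)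

lemma TTHHNest.cross_notMem (h : TTHHNest F) (hU : IsUnimodular (F n)) (h₁ : p.tail < q.tail)
    (h₂ : q.tail < p.head) (h₃ : p.head < q.head) : {p, q} ∉ F n := fun hmem =>
  hU.exchange_notMem h₁.ne h₃.ne (h₁.trans (h₂.trans h₃)).ne h₂.ne hmem (h n _ _ h₁ h₂ h₃)

lemma HHTTNest.cross_notMem (h : HHTTNest F) (hU : IsUnimodular (F n)) (h₁ : p.head < q.head)
    (h₂ : q.head < p.tail) (h₃ : p.tail < q.tail) : {p, q} ∉ F n := fun hmem =>
  hU.exchange_notMem h₃.ne' h₁.ne' (h₁.trans (h₂.trans h₃)).ne' h₂.ne'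
    (pair_comm (α := Arrow n) p q ▸ hmem) (h n _ _ h₁ h₂ h₃)

theorem exists_isCut_of_THTHNest (hF : IsUniform F) (hC : IsSimplicialComplex (F n))
    (hU : IsUnimodular (F n)) (hTHTH : THTHNest F) (hHTHT : ¬HTHTNest F)
    (hS : THHTCross F → HTTHCross F → TTHHNest F ∧ HHTTNest F) {σ : Finset (Arrow n)}
    (hσ : σ ∈ F n) : ∃ k, IsCut σ k := by
  have hpair {p q} (hp : p ∈ σ) (hq : q ∈ σ) : {p, q} ∈ F n := hC.pair_mem hσ hp hq
  refine exists_isCut (fun p hp q hq => hU.tail_ne_head hC hσ hp hq)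
    (fun p hp q hq ⟨h₁, h₂, h₃⟩ => hTHTH.disjoint_notMem hU h₁ h₂ h₃ (hpair hp hq))
    (fun p hp q hq ⟨h₁, h₂, h₃⟩ => hF.notMem_of_not_HTHTNest hHTHT h₁ h₂ h₃ (hpair hp hq)) ?_
  by_cases hTHHT : THHTCross F
  · by_cases hHTTH : HTTHCross F
    · obtain ⟨hTTHH, hHHTT⟩ := hS hTHHT hHTTH
      exact .inr <| .inr
        ⟨fun p hp q hq ⟨h₁, h₂, h₃⟩ => hTTHH.cross_notMem hU h₁ h₂ h₃ (hpair hp hq),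
          fun p hp q hq ⟨h₁, h₂, h₃⟩ => hHHTT.cross_notMem hU h₁ h₂ h₃ (hpair hp hq)⟩
    · exact .inr <| .inl fun p hp q hq ⟨h₁, h₂, h₃⟩ =>
        hF.notMem_of_not_HTTHCross hHTTH h₁ h₂ h₃ (hpair hp hq)
  · exact .inl fun p hp q hq ⟨h₁, h₂, h₃⟩ =>
      hF.notMem_of_not_THHTCross hTHHT h₁ h₂ h₃ (hpair hp hq)

end

/-! ### Arrow counts as heights of the divergence -/

section

variable {n : ℕ} (m : Arrow n → ℕ)

/-- The number of forward arrows of a multiset of arrows. -/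
def forwardCount : ℕ := ∑ p with p.tail < p.head, m p

/-- The number of backward arrows of a multiset of arrows. -/
def backwardCount : ℕ := ∑ p with p.head < p.tail, m p

lemma forwardCount_add_backwardCount : forwardCount m + backwardCount m = ∑ p, m p := by
  rw [forwardCount, backwardCount, ← sum_filter_add_sum_filter_not univ fun p => p.tail < p.head]
  congr 2
  ext p
  have hne : p.head ≠ p.tail := p.2.symm
  simp [hne.le_iff_lt]

lemma sum_divergence_lt (k : ℕ) :
    ∑ i with i.val < k, divergence m i =
      (∑ p with p.tail.val < k, m p : ℕ) - (∑ p with p.head.val < k, m p : ℕ) := by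
  simp [sum_divergence_eq]

lemma sum_divergence_le_forwardCount (k : ℕ) :
    ∑ i with i.val < k, divergence m i ≤ forwardCount m := by
  rw [sum_divergence_lt, sub_le_iff_le_add, forwardCount]
  simp only [sum_filter, ← Nat.cast_add, ← sum_add_distrib]
  gcongr with p
  split_ifs <;> omega

lemma IsCut.sum_divergence {m : Arrow n → ℕ} {k : ℕ} (h : IsCut (arrowSupport m) k) :
    ∑ i with i.val < k, divergence m i = forwardCount m := by
  rw [sum_divergence_lt, sub_eq_iff_eq_add, forwardCount]
  simp only [sum_filter, ← Nat.cast_add, ← sum_add_distrib]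
  congr 2 with p
  by_cases hp : m p = 0
  · simp [hp]
  have := h.1 p (mem_arrowSupport.2 hp)
  have := h.2 p (mem_arrowSupport.2 hp)
  split_ifs <;> omega

lemma IsCut.isGreatest_forwardCount {m : Arrow n → ℕ} {k : ℕ} (h : IsCut (arrowSupport m) k) :
    IsGreatest (Set.range fun k : ℕ => ∑ i with i.val < k, divergence m i)
      (forwardCount m : ℤ) :=
  ⟨⟨k, h.sum_divergence⟩, Set.forall_mem_range.2 (sum_divergence_le_forwardCount m)⟩

end

/-! ### Reversing arrows -/

section

variable {n : ℕ}

/-- The reversal of arrows, which exchanges forward and backward arrows. -/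
def Arrow.rev : Equiv.Perm (Arrow n) where
  toFun p := ⟨p.1.swap, p.2.symm⟩
  invFun p := ⟨p.1.swap, p.2.symm⟩
  left_inv _ := rfl
  right_inv _ := rfl

@[simp] lemma Arrow.tail_rev (p : Arrow n) : (Arrow.rev p).tail = p.head := rfl

@[simp] lemma Arrow.head_rev (p : Arrow n) : (Arrow.rev p).head = p.tail := rfl

lemma sum_comp_rev (m : Arrow n → ℕ) (P : Arrow n → Prop) [DecidablePred P] :
    ∑ p with P p, m (Arrow.rev p) = ∑ p with P (Arrow.rev p), m p := by
  simp only [sum_filter]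
  exact Fintype.sum_equiv Arrow.rev _ _ fun _ => rfl

lemma forwardCount_comp_rev (m : Arrow n → ℕ) :
    forwardCount (m ∘ Arrow.rev) = backwardCount m := sum_comp_rev m _

lemma backwardCount_comp_rev (m : Arrow n → ℕ) :
    backwardCount (m ∘ Arrow.rev) = forwardCount m := sum_comp_rev m _

lemma divergence_comp_rev (m : Arrow n → ℕ) : divergence (m ∘ Arrow.rev) = -divergence m := by
  funext k
  rw [Pi.neg_apply, divergence, divergence, neg_sub]
  exact congrArg₂ (fun a b : ℕ => (a - b : ℤ)) (sum_comp_rev m _) (sum_comp_rev m _)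

lemma map_rev_arrowSupport (m : Arrow n → ℕ) :
    (arrowSupport m).map Arrow.rev.toEmbedding = arrowSupport (m ∘ Arrow.rev) := by
  ext p
  rw [mem_map_equiv]
  simp only [mem_arrowSupport]
  rfl

lemma isSaturated_map_rev {σ : Finset (Arrow n)} :
    IsSaturated (σ.map Arrow.rev.toEmbedding) ↔ IsSaturated σ := by
  simp only [IsSaturated, mem_map_equiv]
  refine or_congr_right <| forall_congr' fun k => ?_
  rw [← Arrow.rev.exists_congr_right]
  simp [or_comm]

end

/-- The collection obtained from `F` by reversing all arrows. -/
def Collection.rev (F : Collection) : Collection :=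
  fun n => {σ | σ.map (Arrow.rev (n := n)).toEmbedding ∈ F n}

section

variable {F : Collection} {n : ℕ}

lemma Collection.rev_rev : F.rev.rev = F := by
  funext n
  ext σ
  have hσ : (σ.map Arrow.rev.toEmbedding).map Arrow.rev.toEmbedding = σ := by
    rw [map_map]
    exact map_refl
  change (σ.map Arrow.rev.toEmbedding).map Arrow.rev.toEmbedding ∈ F n ↔ _
  rw [hσ]

lemma pair_mem_rev {p q : Arrow n} : {p, q} ∈ F.rev n ↔ {Arrow.rev p, Arrow.rev q} ∈ F n := by
  simp [Collection.rev, map_insert]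

lemma arrowSupport_mem_rev {m : Arrow n → ℕ} :
    arrowSupport m ∈ F.rev n ↔ arrowSupport (m ∘ Arrow.rev) ∈ F n := by
  rw [← map_rev_arrowSupport]
  rfl

lemma IsSimplicialComplex.rev (h : IsSimplicialComplex (F n)) : IsSimplicialComplex (F.rev n) where
  empty_mem := h.empty_mem
  singleton_mem p := by simpa [Collection.rev] using h.singleton_mem (Arrow.rev p)
  down_closed σ hσ τ hτ := h.down_closed _ hσ _ (map_subset_map.2 hτ)

lemma IsUniform.rev (h : IsUniform F) : IsUniform F.rev := by
  intro m n p q p' q' horder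
  rw [pair_mem_rev, pair_mem_rev]
  have hnodes {n : ℕ} (p q : Arrow n) (s : Fin 4) :
      nodes (Arrow.rev p) (Arrow.rev q) s = nodes p q (![1, 0, 3, 2] s) := by
    fin_cases s <;> rfl
  exact h _ _ _ _ _ _ fun s t => by simpa only [hnodes] using horder _ _

lemma IsUnimodular.rev (h : IsUnimodular (F n)) : IsUnimodular (F.rev n) := by
  intro d hd
  refine (Equiv.existsUnique_congr (Arrow.rev.arrowCongr (Equiv.refl ℕ)) fun {m} => ?_).2
    (h (-d) (by simp [hd]))
  rw [arrowSupport_mem_rev, ← neg_inj (b := d), ← divergence_comp_rev]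
  rfl

lemma THTHNest_rev : THTHNest F.rev ↔ HTHTNest F :=
  ⟨fun h n p q h₁ h₂ h₃ => pair_mem_rev.1 (h n (Arrow.rev p) (Arrow.rev q) h₁ h₂ h₃),
    fun h n p q h₁ h₂ h₃ => pair_mem_rev.2 (h n (Arrow.rev p) (Arrow.rev q) h₁ h₂ h₃)⟩

lemma HTHTNest_rev : HTHTNest F.rev ↔ THTHNest F := by
  rw [← THTHNest_rev, Collection.rev_rev]

lemma HTTHCross_rev : HTTHCross F.rev ↔ THHTCross F :=
  ⟨fun h n p q h₁ h₂ h₃ => pair_mem_rev.1 (h n (Arrow.rev p) (Arrow.rev q) h₁ h₂ h₃),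
    fun h n p q h₁ h₂ h₃ => pair_mem_rev.2 (h n (Arrow.rev p) (Arrow.rev q) h₁ h₂ h₃)⟩

lemma THHTCross_rev : THHTCross F.rev ↔ HTTHCross F := by
  rw [← HTTHCross_rev, Collection.rev_rev]

lemma HHTTNest_rev : HHTTNest F.rev ↔ TTHHNest F :=
  ⟨fun h n p q h₁ h₂ h₃ => pair_mem_rev.1 (h n (Arrow.rev p) (Arrow.rev q) h₁ h₂ h₃),
    fun h n p q h₁ h₂ h₃ => pair_mem_rev.2 (h n (Arrow.rev p) (Arrow.rev q) h₁ h₂ h₃)⟩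

lemma TTHHNest_rev : TTHHNest F.rev ↔ HHTTNest F := by
  rw [← HHTTNest_rev, Collection.rev_rev]

lemma ncard_saturated_rev (a b : ℕ) :
    {m : Arrow n → ℕ | arrowSupport m ∈ saturated F.rev n ∧
      forwardCount m = a ∧ backwardCount m = b}.ncard =
    {m : Arrow n → ℕ | arrowSupport m ∈ saturated F n ∧
      forwardCount m = b ∧ backwardCount m = a}.ncard := by
  refine Set.ncard_congr' <| Equiv.subtypeEquiv (Arrow.rev.arrowCongr (Equiv.refl ℕ)) fun m => ?_
  change (arrowSupport m ∈ F.rev n ∧ IsSaturated (arrowSupport m)) ∧ _ ↔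
    (arrowSupport (m ∘ Arrow.rev) ∈ F n ∧ IsSaturated (arrowSupport (m ∘ Arrow.rev))) ∧
      forwardCount (m ∘ Arrow.rev) = b ∧ backwardCount (m ∘ Arrow.rev) = a
  rw [arrowSupport_mem_rev, ← map_rev_arrowSupport, isSaturated_map_rev, forwardCount_comp_rev,
    backwardCount_comp_rev, and_comm (a := backwardCount m = b)]

end

/-! ### Integer paths -/

section

/-- The sum of the absolute values of the negative entries. -/
def negSum (l : List ℤ) : ℕ := (l.map fun s => (-s).toNat).sum

/-- The sum of the positive entries. -/
def posSum (l : List ℤ) : ℕ := (l.map fun s => s.toNat).sum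

@[simp] lemma negSum_nil : negSum [] = 0 := rfl

@[simp] lemma negSum_cons (s : ℤ) (l : List ℤ) : negSum (s :: l) = (-s).toNat + negSum l := by
  simp [negSum]

lemma posSum_append (l r : List ℤ) : posSum (l ++ r) = posSum l + posSum r := by
  simp [posSum]

lemma posSum_eq_sum_add_negSum (l : List ℤ) : (posSum l : ℤ) = l.sum + negSum l := by
  induction l with
  | nil => rfl
  | cons s l ih =>
    simp only [posSum, List.map_cons, List.sum_cons, negSum_cons] at ih ⊢
    lia

lemma sum_take_add_sum_drop (l : List ℤ) (k : ℕ) : (l.take k).sum + (l.drop k).sum = l.sum := by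
  rw [← List.sum_append, List.take_append_drop]

/-- A list of integers is read as the steps of a path; this is the path traversed backwards. -/
def reversePath (l : List ℤ) : List ℤ := (l.map Neg.neg).reverse

@[simp] lemma length_reversePath (l : List ℤ) : (reversePath l).length = l.length := by
  simp [reversePath]

@[simp] lemma reversePath_reversePath (l : List ℤ) : reversePath (reversePath l) = l := by
  simp [reversePath]

@[simp] lemma neg_mem_reversePath {s : ℤ} {l : List ℤ} : -s ∈ reversePath l ↔ s ∈ l := by
  simp [reversePath]

@[simp] lemma sum_reversePath (l : List ℤ) : (reversePath l).sum = -l.sum := by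
  simp [reversePath, List.sum_reverse, List.sum_neg]

lemma take_reversePath (l : List ℤ) (k : ℕ) :
    (reversePath l).take k = reversePath (l.drop (l.length - k)) := by
  simp [reversePath, List.take_reverse]

lemma drop_reversePath (l : List ℤ) (k : ℕ) :
    (reversePath l).drop k = reversePath (l.take (l.length - k)) := by
  simp [reversePath, List.drop_reverse]

lemma posSum_reversePath (l : List ℤ) : posSum (reversePath l) = negSum l := by
  simp [posSum, negSum, reversePath, Function.comp_def, List.sum_reverse]

/-- All steps are nonzero and all sums of nonempty suffixes are at least `ε`. -/
def SuffixGE (ε : ℕ) (l : List ℤ) : Prop :=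
  (∀ s ∈ l, s ≠ 0) ∧ ∀ k < l.length, (ε : ℤ) ≤ (l.drop k).sum

@[simp] lemma suffixGE_nil (ε : ℕ) : SuffixGE ε [] := by simp [SuffixGE]

lemma suffixGE_cons {ε : ℕ} {s : ℤ} {l : List ℤ} :
    SuffixGE ε (s :: l) ↔ s ≠ 0 ∧ (ε : ℤ) ≤ s + l.sum ∧ SuffixGE ε l := by
  rw [SuffixGE, List.length_cons, Nat.forall_lt_succ_left]
  simp only [List.forall_mem_cons, List.drop_zero, List.sum_cons, List.drop_succ_cons, SuffixGE]
  tauto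

lemma SuffixGE.sum_drop_nonneg {ε : ℕ} {l : List ℤ} (h : SuffixGE ε l) (k : ℕ) :
    0 ≤ (l.drop k).sum := by
  rcases lt_or_ge k l.length with hk | hk
  · exact (Int.natCast_nonneg ε).trans (h.2 k hk)
  · simp [List.drop_of_length_le hk]

lemma SuffixGE.sum_nonneg {ε : ℕ} {l : List ℤ} (h : SuffixGE ε l) : 0 ≤ l.sum :=
  h.sum_drop_nonneg 0

/-- The closed paths with `N` nonzero steps whose maximal height is `a` and whose up steps add up
to `a + b`. -/
def closedPaths (N a b : ℕ) : Set (List ℤ) :=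
  {w | w.length = N ∧ (∀ s ∈ w, s ≠ 0) ∧ w.sum = 0 ∧
    IsGreatest (Set.range fun k : ℕ => (w.take k).sum) a ∧ posSum w = a + b}

end

/-! ### Splitting a closed path at its first maximum -/

section

variable {l r w : List ℤ} {N a b k : ℕ}

lemma SuffixGE.sum_take_append_lt (hl : SuffixGE 1 l) (hk : k < l.length) :
    ((l ++ r).take k).sum < l.sum := by
  rw [List.take_append_of_le_length hk.le, ← sum_take_add_sum_drop l k, lt_add_iff_pos_right]
  exact hl.2 k hk

lemma SuffixGE.sum_take_append_reversePath_le (hl : SuffixGE 1 l) (hr : SuffixGE 0 r) (k : ℕ) :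
    ((l ++ reversePath r).take k).sum ≤ l.sum := by
  rcases lt_or_ge k l.length with hk | hk
  · exact (hl.sum_take_append_lt hk).le
  · rw [List.take_append, List.take_of_length_le hk, List.sum_append, take_reversePath,
      sum_reversePath, add_neg_le_iff_le_add, le_add_iff_nonneg_right]
    exact hr.sum_drop_nonneg _

lemma append_reversePath_mem_closedPaths (hl : SuffixGE 1 l) (hr : SuffixGE 0 r) (hla : l.sum = a)
    (hra : r.sum = a) :
    l ++ reversePath r ∈ closedPaths (l.length + r.length) a (negSum l + negSum r) := by
  refine ⟨by simp, fun s hs => ?_, by simp [hla, hra], ⟨⟨l.length, by simp [hla]⟩, ?_⟩, ?_⟩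
  · rw [List.mem_append, ← neg_neg s, neg_mem_reversePath, neg_neg] at hs
    exact hs.elim (hl.1 s) fun h => neg_ne_zero.1 (hr.1 _ h)
  · exact Set.forall_mem_range.2 fun k => hla ▸ hl.sum_take_append_reversePath_le hr k
  · have := posSum_eq_sum_add_negSum l
    rw [posSum_append, posSum_reversePath]
    lia

lemma SuffixGE.length_le_of_append_eq {l' r' : List ℤ} (hl' : SuffixGE 1 l')
    (hsum : l.sum = l'.sum) (h : l ++ r = l' ++ r') : l'.length ≤ l.length := by
  by_contra! hlt
  have := hl'.sum_take_append_lt (r := r') hlt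
  rw [← h, List.take_left] at this
  exact this.ne hsum

lemma suffixGE_one_take (hw : ∀ s ∈ w, s ≠ 0)
    (hk : ∀ j < k, (w.take j).sum < (w.take k).sum) : SuffixGE 1 (w.take k) := by
  refine ⟨fun s hs => hw s (List.mem_of_mem_take hs), fun j hj => ?_⟩
  have hjk : j < k := hj.trans_le (List.length_take_le k w)
  have hsplit := sum_take_add_sum_drop (w.take k) j
  rw [List.take_take, min_eq_left hjk.le] at hsplit
  have := hk j hjk
  lia

lemma suffixGE_zero_reversePath_drop (hw : ∀ s ∈ w, s ≠ 0)
    (hk : ∀ j, (w.take j).sum ≤ (w.take k).sum) : SuffixGE 0 (reversePath (w.drop k)) := by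
  refine ⟨fun s hs => ?_, fun j _ => ?_⟩
  · rw [← neg_neg s, neg_mem_reversePath] at hs
    exact neg_ne_zero.1 (hw _ (List.mem_of_mem_drop hs))
  · have := hk (k + ((w.drop k).length - j))
    rw [List.take_add, List.sum_append] at this
    rw [drop_reversePath, sum_reversePath]
    lia

lemma exists_append_reversePath_eq (hw : w ∈ closedPaths N a b) :
    ∃ l r : List ℤ, l ++ reversePath r = w ∧ SuffixGE 1 l ∧ SuffixGE 0 r ∧ l.sum = a ∧
      r.sum = a := by
  obtain ⟨-, hne, hsum, ⟨hattained, hbound⟩, -⟩ := hw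
  classical
  obtain ⟨k, hk, hfirst⟩ : ∃ k, (w.take k).sum = a ∧ ∀ j < k, (w.take j).sum ≠ a :=
    ⟨_, Nat.find_spec hattained, fun _ => Nat.find_min hattained⟩
  have hle (j : ℕ) : (w.take j).sum ≤ (w.take k).sum := hk ▸ hbound ⟨j, rfl⟩
  refine ⟨w.take k, reversePath (w.drop k), by simp,
    suffixGE_one_take hne fun j hj => (hle j).lt_of_ne (hk ▸ hfirst j hj),
    suffixGE_zero_reversePath_drop hne hle, hk, ?_⟩
  rw [sum_reversePath, ← hk, eq_comm, ← add_eq_zero_iff_eq_neg, sum_take_add_sum_drop, hsum]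

/-- The pairs of paths from the two ends of a closed path to its first maximum. -/
def pathPairs (N a b : ℕ) : Set (List ℤ × List ℤ) :=
  {x | x.1.length + x.2.length = N ∧ negSum x.1 + negSum x.2 = b ∧
    SuffixGE 1 x.1 ∧ SuffixGE 0 x.2 ∧ x.1.sum = a ∧ x.2.sum = a}

theorem bijOn_pathPairs_closedPaths (N a b : ℕ) :
    Set.BijOn (fun x => x.1 ++ reversePath x.2) (pathPairs N a b) (closedPaths N a b) := by
  refine ⟨?_, ?_, ?_⟩
  · rintro ⟨l, r⟩ ⟨rfl, rfl, hl, hr, hla, hra⟩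
    exact append_reversePath_mem_closedPaths hl hr hla hra
  · rintro ⟨l, r⟩ ⟨-, -, hl, -, hla, -⟩ ⟨l', r'⟩ ⟨-, -, hl', -, hla', -⟩ heq
    have hlen := (hl.length_le_of_append_eq (hla'.trans hla.symm) heq.symm).antisymm
      (hl'.length_le_of_append_eq (hla.trans hla'.symm) heq)
    obtain ⟨rfl, hrev⟩ := List.append_inj heq hlen
    rw [← reversePath_reversePath r, hrev, reversePath_reversePath]
  · intro w hw
    obtain ⟨l, r, rfl, hl, hr, hla, hra⟩ := exists_append_reversePath_eq hw
    have hlen := hw.1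
    have hpos := hw.2.2.2.2
    have := posSum_eq_sum_add_negSum l
    rw [posSum_append, posSum_reversePath] at hpos
    exact ⟨(l, r), ⟨by simpa using hlen, by simp; lia, hl, hr, hla, hra⟩, rfl⟩

end

/-! ### Counting paths by their first step -/

section

variable {ε n k b : ℕ} {s : ℤ} {l : List ℤ}

/-- Paths of height `k` with suffix sums at least `ε` whose down steps add up to `b`. -/
def IsPath (ε k b : ℕ) (l : List ℤ) : Prop := SuffixGE ε l ∧ l.sum = k ∧ negSum l = b

lemma isPath_nil : IsPath ε k b [] ↔ k = 0 ∧ b = 0 := by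
  simp [IsPath, eq_comm]

lemma isPath_cons : IsPath ε k b (s :: l) ↔ ε ≤ k ∧
    ((∃ j < k, IsPath ε j b l ∧ (k - j : ℤ) = s) ∨
      ∃ e < b, IsPath ε (k + e + 1) (b - e - 1) l ∧ -(e + 1 : ℤ) = s) := by
  simp only [IsPath, suffixGE_cons, List.sum_cons, negSum_cons]
  constructor
  · rintro ⟨⟨hs, hε, hl⟩, hk, hb⟩
    have hsum := hl.sum_nonneg
    refine ⟨by lia, ?_⟩
    rcases lt_or_gt_of_ne hs with hneg | hpos
    · exact .inr ⟨(-s).toNat - 1, by lia, ⟨hl, by lia, by lia⟩, by lia⟩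
    · exact .inl ⟨l.sum.toNat, by lia, ⟨hl, by lia, by lia⟩, by lia⟩
  · rintro ⟨hε, ⟨j, hj, ⟨hl, hsum, hb⟩, rfl⟩ | ⟨e, he, ⟨hl, hsum, hb⟩, rfl⟩⟩
    · exact ⟨⟨by lia, by lia, hl⟩, by lia, by lia⟩
    · exact ⟨⟨by lia, by lia, hl⟩, by lia, by lia⟩

/-- The paths with `n` steps that satisfy `IsPath ε k b`. -/
def pathFinset (ε : ℕ) : ℕ → ℕ → ℕ → Finset (List ℤ)
  | 0, k, b => if k = 0 ∧ b = 0 then {[]} else ∅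
  | n + 1, k, b => if ε ≤ k then
      ((range k).biUnion fun j => (pathFinset ε n j b).image (List.cons (k - j : ℤ))) ∪
        ((range b).biUnion fun e =>
          (pathFinset ε n (k + e + 1) (b - e - 1)).image (List.cons (-(e + 1 : ℤ))))
    else ∅

lemma cons_mem_image_cons {c : ℤ} {S : Finset (List ℤ)} :
    s :: l ∈ S.image (List.cons c) ↔ l ∈ S ∧ c = s := by
  simp [and_comm]

lemma mem_pathFinset : l ∈ pathFinset ε n k b ↔ l.length = n ∧ IsPath ε k b l := by
  induction n generalizing k b l with
  | zero =>
    rw [pathFinset, List.length_eq_zero_iff]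
    split_ifs with h
    · rw [mem_singleton, iff_self_and]
      rintro rfl
      exact isPath_nil.2 h
    · rw [iff_false_intro (notMem_empty l), false_iff]
      rintro ⟨rfl, hnil⟩
      exact h (isPath_nil.1 hnil)
  | succ n ih =>
    cases l with
    | nil => simp only [pathFinset]; split_ifs <;> simp
    | cons s l =>
      rw [isPath_cons, pathFinset]
      split_ifs with h
      · simp only [mem_union, mem_biUnion, mem_range, cons_mem_image_cons, ih, List.length_cons,
          Nat.add_right_cancel_iff]
        by_cases hlen : l.length = n <;> simp [hlen, h]
      · simp [h]

lemma card_biUnion_image_cons {m : ℕ} (f : ℕ → ℤ) (hf : f.Injective)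
    (S : ℕ → Finset (List ℤ)) :
    ((range m).biUnion fun j => (S j).image (List.cons (f j))).card =
      ∑ j ∈ range m, (S j).card := by
  rw [card_biUnion]
  · simp only [card_image_of_injective _ List.cons_injective]
  · intro i _ j _ hij
    rw [Function.onFun, disjoint_left]
    rintro _ hi hj
    obtain ⟨l, -, rfl⟩ := mem_image.1 hi
    obtain ⟨l', -, heq⟩ := mem_image.1 hj
    exact hij (hf (List.cons.inj heq).1.symm)

lemma card_pathFinset_zero :
    (pathFinset ε 0 k b).card = if k = 0 ∧ b = 0 then 1 else 0 := by
  rw [pathFinset, apply_ite card, card_singleton, card_empty]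

lemma card_pathFinset_succ : (pathFinset ε (n + 1) k b).card = if ε ≤ k then
    ∑ j ∈ range k, (pathFinset ε n j b).card +
      ∑ e ∈ range b, (pathFinset ε n (k + e + 1) (b - e - 1)).card else 0 := by
  rw [pathFinset, apply_ite card, card_empty, card_union_of_disjoint,
    card_biUnion_image_cons _ (fun i j h => by simpa using h),
    card_biUnion_image_cons _ (fun i j h => by simpa using h)]
  rw [disjoint_left]
  intro l hup hdown
  simp only [mem_biUnion, mem_image, mem_range] at hup hdown
  obtain ⟨j, hj, l, -, rfl⟩ := hup
  obtain ⟨e, -, l', -, heq⟩ := hdown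
  have := (List.cons.inj heq).1
  lia

theorem ncard_closedPaths (N a b : ℕ) :
    (closedPaths N a b).ncard = ∑ x ∈ antidiagonal N ×ˢ antidiagonal b,
      (pathFinset 1 x.1.1 a x.2.1).card * (pathFinset 0 x.1.2 a x.2.2).card := by
  have hpairs : pathPairs N a b = ((antidiagonal N ×ˢ antidiagonal b).biUnion fun x =>
      pathFinset 1 x.1.1 a x.2.1 ×ˢ pathFinset 0 x.1.2 a x.2.2 : Finset (List ℤ × List ℤ)) := by
    ext ⟨l, r⟩
    simp only [pathPairs, Set.mem_ofPred_eq, coe_biUnion, SetLike.mem_coe,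
      HasAntidiagonal.mem_antidiagonal, coe_product, Set.mem_iUnion, Set.mem_prod,
      mem_pathFinset, IsPath, Prod.exists]
    grind
  rw [← (bijOn_pathPairs_closedPaths N a b).image_eq,
    (bijOn_pathPairs_closedPaths N a b).injOn.ncard_image, hpairs, Set.ncard_coe_finset,
    card_biUnion]
  · simp only [card_product]
  · rintro ⟨⟨n₁, n₂⟩, b₁, b₂⟩ _ ⟨⟨n₁', n₂'⟩, b₁', b₂'⟩ _ hne
    rw [Function.onFun, disjoint_left]
    rintro ⟨l, r⟩ h h'
    simp only [mem_product, mem_pathFinset, IsPath] at h h'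
    grind

end

/-! ### Faces as closed paths -/

section

variable {n : ℕ} {Δ : Set (Finset (Arrow n))} {m : Arrow n → ℕ} {a b : ℕ}

lemma sum_outDegree (m : Arrow n → ℕ) : ∑ k, outDegree m k = ∑ p, m p :=
  sum_fiberwise univ Arrow.tail m

lemma posSum_ofFn (d : Fin n → ℤ) : posSum (List.ofFn d) = ∑ k, (d k).toNat := by
  simp [posSum, List.map_ofFn, List.sum_ofFn]

namespace IsUnimodular

lemma posSum_divergence (hU : IsUnimodular Δ) (hC : IsSimplicialComplex Δ)
    (hm : arrowSupport m ∈ Δ) :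
    posSum (List.ofFn (divergence m)) = forwardCount m + backwardCount m := by
  rw [posSum_ofFn, forwardCount_add_backwardCount, ← sum_outDegree]
  exact sum_congr rfl fun k _ => hU.toNat_divergence hC hm k

lemma isSaturated_iff (hU : IsUnimodular Δ) (hC : IsSimplicialComplex Δ) (hn : n ≠ 0)
    (hm : arrowSupport m ∈ Δ) :
    IsSaturated (arrowSupport m) ↔ ∀ s ∈ List.ofFn (divergence m), s ≠ 0 := by
  simp only [IsSaturated, hn, false_or, List.forall_mem_ofFn_iff,
    hU.divergence_ne_zero_iff hC hm]

lemma ofFn_divergence_mem_closedPaths_iff (hU : IsUnimodular Δ) (hC : IsSimplicialComplex Δ)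
    (hn : n ≠ 0) (hcut : ∀ σ ∈ Δ, ∃ k, IsCut σ k) (hm : arrowSupport m ∈ Δ) :
    List.ofFn (divergence m) ∈ closedPaths (n + 1) a b ↔
      IsSaturated (arrowSupport m) ∧ forwardCount m = a ∧ backwardCount m = b := by
  obtain ⟨k, hk⟩ := hcut _ hm
  have hheight (a : ℕ) : IsGreatest
      (Set.range fun k : ℕ => ∑ i with i.val < k, divergence m i) (a : ℤ) ↔
        forwardCount m = a :=
    ⟨fun h => Nat.cast_injective (hk.isGreatest_forwardCount.unique h),
      fun h => h ▸ hk.isGreatest_forwardCount⟩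
  simp only [closedPaths, Set.mem_ofPred, List.length_ofFn, List.sum_ofFn, sum_divergence,
    List.sum_take_ofFn, hheight, hU.posSum_divergence hC hm, true_and,
    ← hU.isSaturated_iff hC hn hm]
  grind

theorem ncard_saturated_eq_ncard_closedPaths (hU : IsUnimodular Δ) (hC : IsSimplicialComplex Δ)
    (hn : n ≠ 0) (hcut : ∀ σ ∈ Δ, ∃ k, IsCut σ k) (a b : ℕ) :
    {m | (arrowSupport m ∈ Δ ∧ IsSaturated (arrowSupport m)) ∧ forwardCount m = a ∧
      backwardCount m = b}.ncard = (closedPaths (n + 1) a b).ncard := by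
  refine Set.ncard_congr (fun m _ => List.ofFn (divergence m)) ?_ ?_ ?_
  · rintro m ⟨⟨hm, hsat⟩, hab⟩
    exact (hU.ofFn_divergence_mem_closedPaths_iff hC hn hcut hm).2 ⟨hsat, hab⟩
  · rintro m m' ⟨⟨hm, -⟩, -⟩ ⟨⟨hm', -⟩, -⟩ heq
    exact hU.eq_of_divergence_eq hm hm' (List.ofFn_injective heq)
  · intro w hw
    obtain ⟨d, rfl⟩ : ∃ d : Fin (n + 1) → ℤ, List.ofFn d = w :=
      ⟨_, (List.ofFn_congr hw.1 w.get).symm.trans (List.ofFn_get w)⟩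
    obtain ⟨m, ⟨hm, rfl⟩, -⟩ := hU d (List.sum_ofFn.symm.trans hw.2.2.1)
    obtain ⟨hsat, hab⟩ := (hU.ofFn_divergence_mem_closedPaths_iff hC hn hcut hm).1 hw
    exact ⟨m, ⟨⟨hm, hsat⟩, hab⟩, rfl⟩

end IsUnimodular

end

open MvPowerSeries

/-! ### Generating functions of paths -/

section

lemma coeff_X_pow_mul_eq {σ R : Type*} [Semiring R] (s : σ) (e : ℕ) (m : σ →₀ ℕ)
    (f : MvPowerSeries σ R) :
    coeff m (X s ^ e * f) = if e ≤ m s then coeff (m - Finsupp.single s e) f else 0 := by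
  classical
  rw [X_pow_eq, coeff_monomial_mul, one_mul]
  simp only [Finsupp.single_le_iff]

variable {s t : Fin 3} {ε : ℕ} {T : ℕ → MvPowerSeries (Fin 3) ℚ} {c d : ℕ → ℕ → ℕ}
  {f g : MvPowerSeries (Fin 3) ℚ}

lemma finsupp_fin_three_ext (hst : s ≠ t) (hs : s ≠ 2) (ht : t ≠ 2) {m m' : Fin 3 →₀ ℕ}
    (hms : m s = m' s) (hmt : m t = m' t) (hm2 : m 2 = m' 2) : m = m' := by
  ext i
  have : i = s ∨ i = t ∨ i = 2 := by omega
  rcases this with rfl | rfl | rfl <;> assumption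

/-- `f` is the generating function of the numbers `c n b`; the exponent of `X 2` is `n`, the
exponent of `X t` is `b`, and the third variable `X s` does not occur. -/
def IsGenFun (s t : Fin 3) (c : ℕ → ℕ → ℕ) (f : MvPowerSeries (Fin 3) ℚ) : Prop :=
  ∀ m, coeff m f = if m s = 0 then (c (m 2) (m t) : ℚ) else 0

lemma IsGenFun.mul (hst : s ≠ t) (hs : s ≠ 2) (ht : t ≠ 2) (hf : IsGenFun s t c f)
    (hg : IsGenFun s t d g) :
    IsGenFun s t (fun n b => ∑ x ∈ antidiagonal n ×ˢ antidiagonal b,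
      c x.1.1 x.2.1 * d x.1.2 x.2.2) (f * g) := by
  classical
  intro m
  simp only [coeff_mul, hf _, hg _]
  split_ifs with hm
  · have hzero {x : (Fin 3 →₀ ℕ) × (Fin 3 →₀ ℕ)} (hx : x ∈ antidiagonal m) :
        x.1 s = 0 ∧ x.2 s = 0 := by
      rwa [← HasAntidiagonal.mem_antidiagonal.1 hx, Finsupp.add_apply, Nat.add_eq_zero_iff] at hm
    push_cast
    refine sum_bij' (fun x _ => ((x.1 2, x.2 2), (x.1 t, x.2 t)))
      (fun x _ => (Finsupp.single 2 x.1.1 + Finsupp.single t x.2.1,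
        Finsupp.single 2 x.1.2 + Finsupp.single t x.2.2)) ?_ ?_ ?_ ?_ ?_
    · intro x hx
      simp [← HasAntidiagonal.mem_antidiagonal.1 hx]
    · intro x hx
      simp only [mem_product, HasAntidiagonal.mem_antidiagonal] at hx ⊢
      apply finsupp_fin_three_ext hst hs ht
      · simp [hs.symm, hst.symm, hm]
      · simpa [ht.symm] using hx.2
      · simpa [ht] using hx.1
    · intro x hx
      refine Prod.ext ?_ ?_ <;> apply finsupp_fin_three_ext hst hs ht <;>
        simp [hs, ht, hst, ht.symm, hzero hx]
    · intro x _
      simp [ht, ht.symm]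
    · intro x hx
      rw [if_pos (hzero hx).1, if_pos (hzero hx).2]
  · refine sum_eq_zero fun x hx => ?_
    rw [← HasAntidiagonal.mem_antidiagonal.1 hx, Finsupp.add_apply] at hm
    split_ifs <;> simp_all

/-- The recursion for the generating functions of `IsPath ε k` by the first step of a path; the
infinite sum over the down steps is truncated modulo powers of `X t`. -/
def PathRecursion (t : Fin 3) (ε : ℕ) (T : ℕ → MvPowerSeries (Fin 3) ℚ) : Prop :=
  ∀ k N, X t ^ (N + 1) ∣ T k - ((if k = 0 then 1 else 0) + if ε ≤ k then
    X 2 * (∑ j ∈ range k, T j + ∑ e ∈ range N, X t ^ (e + 1) * T (k + e + 1)) else 0)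

namespace PathRecursion

lemma coeff_eq (hT : PathRecursion t ε T) (m : Fin 3 →₀ ℕ) (k : ℕ) :
    coeff m (T k) = (if k = 0 then coeff m 1 else 0) + if ε ≤ k then coeff m (X 2 *
      (∑ j ∈ range k, T j + ∑ e ∈ range (m t), X t ^ (e + 1) * T (k + e + 1))) else 0 := by
  have h := X_pow_dvd_iff.1 (hT k (m t)) m (Nat.lt_succ_self _)
  rwa [map_sub, sub_eq_zero, map_add, apply_ite (coeff m), apply_ite (coeff m), map_zero] at h

lemma coeff_of_eq_zero (hT : PathRecursion t ε T) {m : Fin 3 →₀ ℕ} (hm : m 2 = 0) (k : ℕ) :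
    coeff m (T k) = if k = 0 ∧ m = 0 then 1 else 0 := by
  classical
  rw [hT.coeff_eq, coeff_one, ← ite_and, ← pow_one (X 2), coeff_X_pow_mul_eq,
    if_neg (c := 1 ≤ m 2) (by omega), ite_self, add_zero]

lemma coeff_add_single (hT : PathRecursion t ε T) (ht : t ≠ 2) (m : Fin 3 →₀ ℕ) (k : ℕ) :
    coeff (m + Finsupp.single 2 1) (T k) = if ε ≤ k then
      ∑ j ∈ range k, coeff m (T j) +
        ∑ e ∈ range (m t), coeff (m - Finsupp.single t (e + 1)) (T (k + e + 1)) else 0 := by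
  classical
  have hne : m + Finsupp.single 2 1 ≠ 0 := by simp
  rw [hT.coeff_eq, coeff_one, if_neg hne, ite_self, zero_add,
    ← pow_one (X 2), coeff_X_pow_mul_eq]
  simp only [Finsupp.add_apply, Finsupp.single_eq_same, Finsupp.single_eq_of_ne ht, add_zero,
    le_add_iff_nonneg_left, zero_le, if_true, add_tsub_cancel_right, map_add, map_sum]
  congr 2
  refine sum_congr rfl fun e he => ?_
  rw [coeff_X_pow_mul_eq, if_pos (Nat.succ_le_of_lt (mem_range.1 he))]

theorem isGenFun (hT : PathRecursion t ε T) (hst : s ≠ t) (hs : s ≠ 2) (ht : t ≠ 2) (k : ℕ) :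
    IsGenFun s t (fun n b => (pathFinset ε n k b).card) (T k) := by
  intro m
  induction hn : m 2 generalizing m k with
  | zero =>
    have hm : m = 0 ↔ m s = 0 ∧ m t = 0 :=
      ⟨fun h => by simp [h], fun h => finsupp_fin_three_ext hst hs ht h.1 h.2 hn⟩
    simp only [hT.coeff_of_eq_zero hn, card_pathFinset_zero, hm]
    by_cases hms : m s = 0 <;> simp [hms]
  | succ n ih =>
    obtain ⟨m, rfl⟩ : ∃ m', m = m' + Finsupp.single 2 1 :=
      ⟨m - Finsupp.single 2 1, (tsub_add_cancel_of_le (by simp [hn])).symm⟩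
    have hm : m 2 = n := by simpa using hn
    have hdown (e : ℕ) : (m - Finsupp.single t (e + 1)) 2 = n := by simp [ht.symm, hm]
    rw [hT.coeff_add_single ht]
    simp only [ih _ _ hm, ih _ _ (hdown _), card_pathFinset_succ]
    by_cases hms : m s = 0 <;> simp [hs, ht, hst, Nat.sub_sub, hms]

end PathRecursion

end

/-! ### Solving the recursion -/

section

variable {s t : Fin 3} {c y C i q H : MvPowerSeries (Fin 3) ℚ}

/-- The geometric ansatz for the generating functions of paths of height `k`. -/
noncomputable def pathSeries (c C : MvPowerSeries (Fin 3) ℚ) (k : ℕ) : MvPowerSeries (Fin 3) ℚ :=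
  if k = 0 then c else c * (X 2 * C * (1 + X 2 * C) ^ (k - 1))

lemma pathSeries_zero : pathSeries c C 0 = c := if_pos rfl

lemma pathSeries_succ (k : ℕ) :
    pathSeries c C (k + 1) = c * (X 2 * C * (1 + X 2 * C) ^ k) := by
  simp [pathSeries]

lemma sum_range_pathSeries (k : ℕ) :
    ∑ j ∈ range (k + 1), pathSeries c C j = c * (1 + X 2 * C) ^ k := by
  induction k with
  | zero => simp [pathSeries_zero]
  | succ k ih => rw [sum_range_succ, ih, pathSeries_succ]; ring

lemma sum_range_pow_mul_pathSeries (k N : ℕ) :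
    ∑ e ∈ range N, y ^ (e + 1) * pathSeries c C (k + e + 1) =
      c * (X 2 * C * (1 + X 2 * C) ^ k) * y * ∑ e ∈ range N, (y * (1 + X 2 * C)) ^ e := by
  rw [mul_sum]
  refine sum_congr rfl fun e _ => ?_
  rw [pathSeries_succ, mul_pow]
  ring

/-- The functional equation of the Catalan series `C(y z (z + 1))` with `z = X 2` after the
substitution `y = X t / (1 - X t)`. -/
def CatalanEq (t : Fin 3) (C : MvPowerSeries (Fin 3) ℚ) : Prop :=
  C - 1 = X t * (1 + X 2 * C) * (C - 1 + X 2 * C)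

namespace CatalanEq

lemma dvd_pathSeries_succ_sub (hC : CatalanEq t C) (c : MvPowerSeries (Fin 3) ℚ) (k N : ℕ) :
    X t ^ (N + 1) ∣ pathSeries c C (k + 1) - X 2 * (∑ j ∈ range (k + 1), pathSeries c C j +
      ∑ e ∈ range N, X t ^ (e + 1) * pathSeries c C (k + 1 + e + 1)) := by
  rw [sum_range_pathSeries, sum_range_pow_mul_pathSeries, pathSeries_succ]
  have hgeom := mul_neg_geom_sum (X t * (1 + X 2 * C)) N
  rw [CatalanEq] at hC
  refine ⟨c * X 2 * (1 + X 2 * C) ^ k * (1 + X 2 * C) ^ (N + 1) * (C - 1 + X 2 * C), ?_⟩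
  generalize ∑ e ∈ range N, (X t * (1 + X 2 * C)) ^ e = G at hgeom ⊢
  rw [mul_pow] at hgeom
  linear_combination c * X 2 * (1 + X 2 * C) ^ k *
    ((G + X t ^ N * (1 + X 2 * C) ^ N) * hC - (C - 1) * hgeom)

lemma dvd_pathSeries_zero_sub (hC : CatalanEq t C) (hi : i * (1 + X 2) = 1) (N : ℕ) :
    X t ^ (N + 1) ∣ pathSeries (i * (1 + X 2 * C)) C 0 - (1 + X 2 *
      ∑ e ∈ range N, X t ^ (e + 1) * pathSeries (i * (1 + X 2 * C)) C (0 + e + 1)) := by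
  rw [sum_range_pow_mul_pathSeries, pathSeries_zero, pow_zero, mul_one]
  have hgeom := mul_neg_geom_sum (X t * (1 + X 2 * C)) N
  rw [CatalanEq] at hC
  refine ⟨i * X 2 * (1 + X 2 * C) ^ (N + 1) * (C - 1 + X 2 * C), ?_⟩
  generalize ∑ e ∈ range N, (X t * (1 + X 2 * C)) ^ e = G at hgeom ⊢
  rw [mul_pow] at hgeom
  linear_combination hi + i * X 2 *
    ((G + X t ^ N * (1 + X 2 * C) ^ N) * hC - (C - 1) * hgeom)

lemma pathRecursion_one (hC : CatalanEq t C) : PathRecursion t 1 (pathSeries 1 C)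
  | 0, N => by simp [pathSeries_zero]
  | k + 1, N => by simpa using hC.dvd_pathSeries_succ_sub 1 k N

lemma pathRecursion_zero (hC : CatalanEq t C) (hi : i * (1 + X 2) = 1) :
    PathRecursion t 0 (pathSeries (i * (1 + X 2 * C)) C)
  | 0, N => by simpa using hC.dvd_pathSeries_zero_sub hi N
  | k + 1, N => by simpa using hC.dvd_pathSeries_succ_sub (i * (1 + X 2 * C)) k N

lemma coeff_pathSeries_mul (hC : CatalanEq t C) (hi : i * (1 + X 2) = 1) (hst : s ≠ t)
    (hs : s ≠ 2) (ht : t ≠ 2) (m : Fin 3 →₀ ℕ) (a : ℕ) :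
    coeff m (pathSeries 1 C a * pathSeries (i * (1 + X 2 * C)) C a) =
      if m s = 0 then ((closedPaths (m 2) a (m t)).ncard : ℚ) else 0 := by
  rw [ncard_closedPaths]
  exact (hC.pathRecursion_one.isGenFun hst hs ht a).mul hst hs ht
    ((hC.pathRecursion_zero hi).isGenFun hst hs ht a) m

end CatalanEq

lemma sum_range_pow_mul_pathSeries_mul (N : ℕ) :
    ∑ a ∈ range (N + 1), y ^ a * (pathSeries 1 C a * pathSeries q C a) =
      q + y * X 2 ^ 2 * C ^ 2 * q * ∑ a ∈ range N, (y * (1 + X 2 * C) ^ 2) ^ a := by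
  rw [sum_range_succ', mul_sum, add_comm]
  congr 1
  · simp [pathSeries_zero]
  · refine sum_congr rfl fun a _ => ?_
    rw [pathSeries_succ, pathSeries_succ, mul_pow, ← pow_mul]
    ring

lemma dvd_sub_sum_range_pow_mul_pathSeries_mul
    (hH : H * (1 - y * (1 + X 2 * C) ^ 2) = y * X 2 ^ 2 * C ^ 2 * q) (N : ℕ) :
    y ^ (N + 1) ∣ (q + H) -
      ∑ a ∈ range (N + 1), y ^ a * (pathSeries 1 C a * pathSeries q C a) := by
  rw [sum_range_pow_mul_pathSeries_mul]
  have hgeom := mul_neg_geom_sum (y * (1 + X 2 * C) ^ 2) N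
  refine ⟨(1 + X 2 * C) ^ (2 * N) * (H * (1 + X 2 * C) ^ 2 + X 2 ^ 2 * C ^ 2 * q), ?_⟩
  generalize ∑ a ∈ range N, (y * (1 + X 2 * C) ^ 2) ^ a = G at hgeom ⊢
  rw [mul_pow, ← pow_mul] at hgeom
  linear_combination (G + y ^ N * (1 + X 2 * C) ^ (2 * N)) * hH - H * hgeom

/-- The summand `H` collects the closed paths of positive maximal height. -/
theorem CatalanEq.coeff_closedPaths (hC : CatalanEq t C) (hi : i * (1 + X 2) = 1)
    (hH : H * (1 - X s * (1 + X 2 * C) ^ 2) = X s * X 2 ^ 2 * C ^ 2 * (i * (1 + X 2 * C)))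
    (hst : s ≠ t) (hs : s ≠ 2) (ht : t ≠ 2) (m : Fin 3 →₀ ℕ) :
    coeff m (i * (1 + X 2 * C) + H) = ((closedPaths (m 2) (m s) (m t)).ncard : ℚ) := by
  have h := X_pow_dvd_iff.1 (dvd_sub_sum_range_pow_mul_pathSeries_mul hH (m s)) m
    (Nat.lt_succ_self _)
  rw [map_sub, sub_eq_zero] at h
  rw [h, map_sum, sum_eq_single_of_mem (m s) (self_mem_range_succ _)]
  · rw [coeff_X_pow_mul_eq, if_pos le_rfl, hC.coeff_pathSeries_mul hi hst hs ht]
    simp [hs, hst]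
  · intro a ha hne
    have hlt : a < m s := lt_of_le_of_ne (mem_range_succ_iff.1 ha) hne
    rw [coeff_X_pow_mul_eq, if_pos hlt.le, hC.coeff_pathSeries_mul hi hst hs ht, if_neg]
    simpa using Nat.sub_ne_zero_of_lt hlt

end

/-! ### From faces to multisets supported on faces -/

/-- The substitution `x ↦ x / (1 - x)`, `y ↦ y / (1 - y)`, `z ↦ z`, which turns the generating
function of faces into that of the multisets supported on faces. -/
noncomputable def multisetSubst : Fin 3 → MvPowerSeries (Fin 3) ℚ :=
  fun i => if i = 2 then X 2 else X i * (1 - X i)⁻¹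

lemma multisetSubst_two : multisetSubst 2 = X 2 := if_pos rfl

lemma multisetSubst_mul {i : Fin 3} (hi : i ≠ 2) : multisetSubst i * (1 - X i) = X i := by
  rw [multisetSubst, if_neg hi, mul_assoc, MvPowerSeries.inv_mul_cancel _ (by simp), mul_one]

lemma hasSubst_multisetSubst : HasSubst multisetSubst := by
  refine hasSubst_of_constantCoeff_zero fun i => ?_
  by_cases hi : i = 2 <;> simp [multisetSubst, hi]

lemma subst_multisetSubst_injective :
    Function.Injective
      (subst multisetSubst : MvPowerSeries (Fin 3) ℚ → MvPowerSeries (Fin 3) ℚ) := by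
  let b : Fin 3 → MvPowerSeries (Fin 3) ℚ := fun i => if i = 2 then X 2 else X i * (1 + X i)⁻¹
  have hb : HasSubst b := by
    refine hasSubst_of_constantCoeff_zero fun i => ?_
    by_cases hi : i = 2 <;> simp [b, hi]
  have subst_b : (fun i => subst b (multisetSubst i)) = X := by
    funext i
    by_cases hi : i = 2
    · rw [hi, multisetSubst_two, subst_X hb]
      exact if_pos rfl
    · have h := congrArg (substAlgHom (R := ℚ) hb) (multisetSubst_mul hi)
      rw [map_mul, map_sub, map_one, substAlgHom_X, substAlgHom_apply] at h
      have hbi : b i * (1 + X i) = X i := by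
        simp only [b, if_neg hi]
        rw [mul_assoc, MvPowerSeries.inv_mul_cancel _ (by simp), mul_one]
      linear_combination (1 + X i) * h + (subst b (multisetSubst i) + 1) * hbi
  refine Function.LeftInverse.injective (g := subst b) fun f => ?_
  rw [subst_comp_subst_apply hasSubst_multisetSubst hb, subst_b, subst_self, id]

lemma coeff_multisetSubst {i : Fin 3} (hi : i ≠ 2) (e : Fin 3 →₀ ℕ) :
    coeff e (multisetSubst i) = if e = Finsupp.single i (e i) ∧ e i ≠ 0 then 1 else 0 := by
  have eq_single {f : Fin 3 →₀ ℕ} {k : ℕ} :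
      f = Finsupp.single i k ↔ (∀ j ≠ i, f j = 0) ∧ f i = k := by
    rw [Finsupp.eq_single_iff]
    exact and_congr_left' (by simp [Finset.subset_iff, not_imp_comm])
  have hrec : multisetSubst i = X i + X i ^ 1 * multisetSubst i := by
    linear_combination multisetSubst_mul hi
  induction hk : e i generalizing e with
  | zero =>
    rw [hrec, map_add, coeff_X_pow_mul_eq, if_neg (by omega), coeff_X]
    simp [eq_single, hk]
  | succ k ih =>
    rw [hrec, map_add, coeff_X_pow_mul_eq, if_pos (by omega), ih _ (by simp [hk]), coeff_X]
    have hsub : (∀ j ≠ i, (e - Finsupp.single i 1 : Fin 3 →₀ ℕ) j = 0) ↔ ∀ j ≠ i, e j = 0 :=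
      forall₂_congr fun j hj => by simp [hj]
    by_cases he : ∀ j ≠ i, e j = 0 <;> by_cases hk0 : k = 0 <;>
      simp only [eq_single, hsub] <;> simp [he, hk, hk0]

/-- The index of the variable that marks an arrow: `x` if it is forward, `y` if it is backward. -/
def arrowVar {n : ℕ} (p : Arrow n) : Fin 3 := if p.tail < p.head then 0 else 1

lemma arrowVar_ne_two {n : ℕ} (p : Arrow n) : arrowVar p ≠ 2 := by
  rw [arrowVar]; split_ifs <;> decide

/-- The exponents of `x`, `y` and `z` in the monomial of a multiset of arrows. -/
noncomputable def arrowExponent {n : ℕ} (m : Arrow n → ℕ) : Fin 3 →₀ ℕ :=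
  ∑ p, Finsupp.single (arrowVar p) (m p) + Finsupp.single 2 n

lemma arrowExponent_eq {n : ℕ} (m : Arrow n → ℕ) :
    arrowExponent m = Finsupp.single 0 (forwardCount m) + Finsupp.single 1 (backwardCount m) +
      Finsupp.single 2 n := by
  rw [arrowExponent, forwardCount, backwardCount, Finsupp.single_finsetSum,
    Finsupp.single_finsetSum, sum_filter, sum_filter, ← sum_add_distrib]
  congr 1
  refine sum_congr rfl fun p _ => ?_
  rcases lt_or_gt_of_ne p.2 with h | h <;> simp [arrowVar, h, h.asymm]

lemma arrowExponent_eq_iff {n : ℕ} {m : Arrow n → ℕ} {e : Fin 3 →₀ ℕ} :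
    arrowExponent m = e ↔ forwardCount m = e 0 ∧ backwardCount m = e 1 ∧ n = e 2 := by
  rw [arrowExponent_eq]
  constructor
  · rintro rfl
    simp
  · rintro ⟨h0, h1, h2⟩
    apply finsupp_fin_three_ext (s := 0) (t := 1) (by decide) (by decide) (by decide) <;>
      simp [h0, h1, h2]

lemma finite_arrowExponent_eq (n : ℕ) (e : Fin 3 →₀ ℕ) :
    {m : Arrow n → ℕ | arrowExponent m = e}.Finite := by
  refine (Set.finite_Iic fun p : Arrow n => e (arrowVar p)).subset ?_
  rintro m rfl p
  calc m p = Finsupp.single (arrowVar p) (m p) (arrowVar p) := by simp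
    _ ≤ ∑ q, Finsupp.single (arrowVar q) (m q) (arrowVar p) :=
      single_le_sum (f := fun q => Finsupp.single (arrowVar q) (m q) (arrowVar p))
        (fun _ _ => Nat.zero_le _) (mem_univ p)
    _ ≤ arrowExponent m (arrowVar p) := by simp [arrowExponent]

/-- The exponents of `x`, `y` and `z` in the monomial of a set of arrows. -/
noncomputable def faceExponent {n : ℕ} (σ : Finset (Arrow n)) : Fin 3 →₀ ℕ :=
  arrowExponent fun p => if p ∈ σ then 1 else 0

lemma prod_faceExponent {n : ℕ} (σ : Finset (Arrow n)) :
    (faceExponent σ).prod (fun i k => multisetSubst i ^ k) =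
      X 2 ^ n * ∏ p ∈ σ, multisetSubst (arrowVar p) := by
  rw [faceExponent, arrowExponent,
    Finsupp.prod_add_index' (fun _ => pow_zero _) (fun _ => pow_add _),
    ← Finsupp.prod_finsetSum_index (fun _ => pow_zero _) (fun _ => pow_add _)]
  simp only [Finsupp.prod_single_index, pow_zero, multisetSubst_two]
  rw [mul_comm]
  simp only [pow_ite, pow_one, pow_zero, prod_ite_mem, univ_inter]

lemma coeff_prod_multisetSubst {n : ℕ} (σ : Finset (Arrow n)) (e : Fin 3 →₀ ℕ) :
    coeff e (∏ p ∈ σ, multisetSubst (arrowVar p)) =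
      ({m : Arrow n → ℕ | arrowSupport m = σ ∧
        ∑ p, Finsupp.single (arrowVar p) (m p) = e}.ncard : ℚ) := by
  let f : (Arrow n → ℕ) → Arrow n →₀ Fin 3 →₀ ℕ := fun m =>
    Finsupp.equivFunOnFinite.symm fun p => Finsupp.single (arrowVar p) (m p)
  have hf : Function.Injective f := fun m m' h => funext fun p =>
    Finsupp.single_injective _ (DFunLike.congr_fun h p)
  have prod_eq (l : Arrow n →₀ Fin 3 →₀ ℕ) :
      ∏ p ∈ σ, coeff (l p) (multisetSubst (arrowVar p)) = if ∀ p ∈ σ,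
        l p = Finsupp.single (arrowVar p) (l p (arrowVar p)) ∧ l p (arrowVar p) ≠ 0
        then 1 else 0 := by
    rw [prod_congr rfl fun p _ => coeff_multisetSubst (arrowVar_ne_two p) _, prod_boole]
    congr
  rw [coeff_prod, sum_congr rfl fun l _ => prod_eq l, sum_boole,
    ← Set.ncard_image_of_injective _ hf, ← Set.ncard_coe_finset]
  congr 2
  ext l
  simp only [coe_filter, mem_finsuppAntidiag, Set.mem_ofPred_eq, Set.mem_image]
  constructor
  · rintro ⟨⟨hsum, hsupp⟩, hl⟩
    have hzero (p) (hp : p ∉ σ) : l p = 0 := Finsupp.notMem_support_iff.1 fun h => hp (hsupp h)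
    have hsingle (p) : Finsupp.single (arrowVar p) (l p (arrowVar p)) = l p := by
      by_cases hp : p ∈ σ
      · exact (hl p hp).1.symm
      · simp [hzero p hp]
    refine ⟨fun p => l p (arrowVar p), ⟨?_, ?_⟩, Finsupp.ext hsingle⟩
    · ext p
      rw [mem_arrowSupport]
      exact ⟨fun h => by_contra fun hp => h (by simp [hzero p hp]), fun hp => (hl p hp).2⟩
    · simp only [hsingle, ← hsum]
      exact (sum_subset (subset_univ σ) fun p _ => hzero p).symm
  · rintro ⟨m, ⟨rfl, rfl⟩, rfl⟩
    simpa [f] using sum_subset (subset_univ _) fun p _ hp => by simpa using hp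

lemma coeff_prod_faceExponent {n : ℕ} (σ : Finset (Arrow n)) (e : Fin 3 →₀ ℕ) :
    coeff e ((faceExponent σ).prod fun i k => multisetSubst i ^ k) =
      ({m : Arrow n → ℕ | arrowSupport m = σ ∧ arrowExponent m = e}.ncard : ℚ) := by
  rw [prod_faceExponent, coeff_X_pow_mul_eq]
  split_ifs with h
  · rw [coeff_prod_multisetSubst]
    simp only [arrowExponent, eq_tsub_iff_add_eq_of_le (Finsupp.single_le_iff.2 h)]
  · have : {m : Arrow n → ℕ | arrowSupport m = σ ∧ arrowExponent m = e} = ∅ := by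
      refine Set.eq_empty_iff_forall_notMem.2 fun m hm => h ?_
      exact (arrowExponent_eq_iff.1 hm.2).2.2.le
    rw [this, Set.ncard_empty, Nat.cast_zero]

lemma coeff_faceSeries (G : Collection) {n : ℕ} {d : Fin 3 →₀ ℕ} (hd : d 2 = n) :
    coeff d (faceSeries G) = ({σ : Finset (Arrow n) | σ ∈ G n ∧ faceExponent σ = d}.ncard : ℚ) := by
  subst hd
  change (faceCount (G (d 2)) (d 0) (d 1) : ℚ) = _
  simp only [faceCount, faceExponent, arrowExponent_eq_iff, forwardCount, backwardCount,
    sum_ite_mem, sum_const, smul_eq_mul, mul_one, filter_inter, univ_inter, and_true]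

lemma ncard_arrowSupport_mem {n : ℕ} (Φ : Finset (Finset (Arrow n))) (e : Fin 3 →₀ ℕ) :
    {m : Arrow n → ℕ | arrowSupport m ∈ Φ ∧ arrowExponent m = e}.ncard =
      ∑ σ ∈ Φ, {m : Arrow n → ℕ | arrowSupport m = σ ∧ arrowExponent m = e}.ncard := by
  have ncard_eq (P : Finset (Arrow n) → Prop) [DecidablePred P] :
      {m : Arrow n → ℕ | P (arrowSupport m) ∧ arrowExponent m = e}.ncard =
        #{m ∈ (finite_arrowExponent_eq n e).toFinset | P (arrowSupport m)} := by
    rw [← Set.ncard_coe_finset]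
    congr 1
    ext m
    simp [and_comm]
  rw [ncard_eq (· ∈ Φ)]
  rw [card_eq_sum_card_fiberwise (f := arrowSupport) (t := Φ) fun m hm =>
    mem_coe.2 (mem_filter.1 (mem_coe.1 hm)).2]
  refine sum_congr rfl fun σ hσ => ?_
  rw [ncard_eq (· = σ), filter_filter]
  congr 1
  grind

theorem coeff_subst_faceSeries (G : Collection) (e : Fin 3 →₀ ℕ) :
    coeff e (subst multisetSubst (faceSeries G)) =
      ({m : Arrow (e 2) → ℕ | arrowSupport m ∈ G (e 2) ∧ forwardCount m = e 0 ∧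
        backwardCount m = e 1}.ncard : ℚ) := by
  classical
  let Φ : Finset (Finset (Arrow (e 2))) := {σ | σ ∈ G (e 2)}
  let c : (Fin 3 →₀ ℕ) → ℚ := fun d => coeff e (d.prod fun i k => multisetSubst i ^ k)
  have coeff_eq (d) (hd : d 2 = e 2) :
      coeff d (faceSeries G) = (#{σ ∈ Φ | faceExponent σ = d} : ℚ) := by
    rw [coeff_faceSeries G hd, ← Set.ncard_coe_finset]
    simp [Φ]
  have support_subset :
      (Function.support fun d => coeff d (faceSeries G) • c d) ⊆ ↑(Φ.image faceExponent) := by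
    intro d hd
    obtain ⟨hGd, hcd⟩ := smul_ne_zero_iff.1 hd
    have hd2 : d 2 = e 2 := by
      rw [coeff_faceSeries G rfl, Nat.cast_ne_zero] at hGd
      obtain ⟨σ, -, hσ⟩ := Set.nonempty_of_ncard_ne_zero hGd
      simp only [c] at hcd
      rw [← hσ, coeff_prod_faceExponent, Nat.cast_ne_zero] at hcd
      obtain ⟨m, -, hm⟩ := Set.nonempty_of_ncard_ne_zero hcd
      exact (arrowExponent_eq_iff.1 hm).2.2
    rw [coeff_eq d hd2, Nat.cast_ne_zero, card_ne_zero] at hGd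
    obtain ⟨σ, hσ⟩ := hGd
    exact mem_coe.2 (mem_image.2 ⟨σ, mem_filter.1 hσ⟩)
  calc coeff e (subst multisetSubst (faceSeries G))
      = ∑ d ∈ Φ.image faceExponent, coeff d (faceSeries G) • c d := by
        rw [coeff_subst hasSubst_multisetSubst, finsum_eq_sum_of_support_subset _ support_subset]
    _ = ∑ d ∈ Φ.image faceExponent, #{σ ∈ Φ | faceExponent σ = d} • c d := by
        refine sum_congr rfl fun d hd => ?_
        obtain ⟨σ, -, rfl⟩ := mem_image.1 hd
        rw [coeff_eq (faceExponent σ) (arrowExponent_eq_iff.1 rfl).2.2.symm, smul_eq_mul,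
          nsmul_eq_mul]
    _ = ∑ σ ∈ Φ, c (faceExponent σ) := (sum_comp c faceExponent).symm
    _ = _ := by
        simp only [c, coeff_prod_faceExponent]
        rw [← Nat.cast_sum, ← ncard_arrowSupport_mem]
        simp [Φ, arrowExponent_eq_iff]

/-! ### The refined face enumeration -/

section

variable {s t : Fin 3}

lemma catalanAt_eq {u : MvPowerSeries (Fin 3) ℚ} (hu : constantCoeff u = 0) :
    catalanAt u = 1 + u * catalanAt u ^ 2 := by
  have hu' : PowerSeries.HasSubst u := PowerSeries.HasSubst.of_constantCoeff_zero hu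
  have h := congrArg (PowerSeries.substAlgHom (R := ℚ) hu')
    (congrArg (PowerSeries.map (Nat.castRingHom ℚ)) PowerSeries.catalanSeries_sq_mul_X_add_one)
  simp only [map_add, map_mul, map_pow, map_one, PowerSeries.map_X, PowerSeries.coe_substAlgHom,
    PowerSeries.subst_X hu'] at h
  rw [catalanAt]
  linear_combination -h

lemma catalanEq_subst_catalanAt (ht : t ≠ 2) :
    CatalanEq t (subst multisetSubst (catalanAt (X t * X 2 * (X 2 + 1)))) := by
  have h := congrArg (substAlgHom (R := ℚ) hasSubst_multisetSubst)
    (catalanAt_eq (u := X t * X 2 * (X 2 + 1)) (by simp))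
  simp only [map_add, map_mul, map_pow, map_one, substAlgHom_X, multisetSubst_two] at h
  rw [substAlgHom_apply] at h
  generalize subst multisetSubst (catalanAt (X t * X 2 * (X 2 + 1))) = C at h ⊢
  rw [CatalanEq]
  linear_combination (1 - X t) * h + X 2 * (X 2 + 1) * C ^ 2 * multisetSubst_mul ht

lemma exists_subst_simionSeries_eq (hs : s ≠ 2) (ht : t ≠ 2) :
    ∃ C i H : MvPowerSeries (Fin 3) ℚ, CatalanEq t C ∧ i * (1 + X 2) = 1 ∧
      H * (1 - X s * (1 + X 2 * C) ^ 2) = X s * X 2 ^ 2 * C ^ 2 * (i * (1 + X 2 * C)) ∧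
      1 + X 2 * (subst multisetSubst (simionSeries (X s) (X t) (X 2)) - 1) =
        i * (1 + X 2 * C) + H := by
  set C₀ := catalanAt (X t * X 2 * (X 2 + 1))
  set d₀ : MvPowerSeries (Fin 3) ℚ :=
    (1 + X 2) * (1 - 2 * C₀ * X s * X 2 - C₀ ^ 2 * X s * X 2 ^ 2) with hd₀
  let φ := substAlgHom (R := ℚ) hasSubst_multisetSubst
  have hi := congrArg φ
    (MvPowerSeries.inv_mul_cancel (1 + X 2 : MvPowerSeries (Fin 3) ℚ) (by simp))
  have hj := congrArg φ (MvPowerSeries.inv_mul_cancel d₀ (by simp [hd₀]))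
  have hsubst : subst multisetSubst (simionSeries (X s) (X t) (X 2)) =
      φ ((C₀ + X 2) * (1 + X 2)⁻¹ + X s * X 2 * (1 + X 2 * C₀) * C₀ ^ 2 * d₀⁻¹) :=
    (substAlgHom_apply _ _).symm
  have hC : CatalanEq t (φ C₀) := by
    rw [substAlgHom_apply]
    exact catalanEq_subst_catalanAt ht
  have hφX (k) : φ (X k) = multisetSubst k := substAlgHom_X _ _
  rw [hsubst]
  simp only [hd₀, map_add, map_mul, map_sub, map_pow, map_one, map_ofNat, hφX,
    multisetSubst_two] at hi hj ⊢
  generalize φ C₀ = C at hC hj ⊢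
  generalize φ (1 + X 2)⁻¹ = i at hi ⊢
  generalize φ _ = j at hj ⊢
  have hij : i = j * (1 - 2 * C * multisetSubst s * X 2 - C ^ 2 * multisetSubst s * X 2 ^ 2) := by
    linear_combination
      j * (1 - 2 * C * multisetSubst s * X 2 - C ^ 2 * multisetSubst s * X 2 ^ 2) * hi - i * hj
  refine ⟨C, i, X 2 * (multisetSubst s * X 2 * (1 + X 2 * C) * C ^ 2 * j), hC, hi, ?_, ?_⟩
  · rw [hij]
    linear_combination X 2 ^ 2 * (1 + X 2 * C) * C ^ 2 * j * multisetSubst_mul hs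
  · linear_combination (X 2 - 1) * hi

theorem coeff_subst_simionSeries (hst : s ≠ t) (hs : s ≠ 2) (ht : t ≠ 2) (m : Fin 3 →₀ ℕ) :
    coeff m (1 + X 2 * (subst multisetSubst (simionSeries (X s) (X t) (X 2)) - 1)) =
      ((closedPaths (m 2) (m s) (m t)).ncard : ℚ) := by
  obtain ⟨C, i, H, hC, hi, hH, h⟩ := exists_subst_simionSeries_eq hs ht
  rw [h, hC.coeff_closedPaths hi hH hst hs ht]

lemma ncard_closedPaths_zero (a b : ℕ) :
    (closedPaths 0 a b).ncard = if a = 0 ∧ b = 0 then 1 else 0 := by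
  have h : closedPaths 0 a b = {w | w = [] ∧ a = 0 ∧ b = 0} := by
    ext w
    simp only [closedPaths, List.length_eq_zero_iff, Set.mem_ofPred_eq, and_congr_right_iff]
    rintro rfl
    simp only [List.not_mem_nil, ne_eq, IsEmpty.forall_iff, implies_true, List.sum_nil,
      List.take_nil, Set.range_const, isGreatest_singleton.isGreatest_iff_eq, posSum, List.map_nil,
      true_and]
    omega
  rw [h]
  split_ifs with hab <;> simp [hab]

lemma closedPaths_one (a b : ℕ) : closedPaths 1 a b = ∅ := by
  refine Set.eq_empty_iff_forall_notMem.2 fun w ⟨hlen, hne, hsum, _⟩ => ?_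
  obtain ⟨c, rfl⟩ := List.length_eq_one_iff.1 hlen
  exact hne c (by simp) (by simpa using hsum)

lemma coeff_subst_faceSeries_of_eq_zero {F : Collection} (hC : IsSimplicialComplex (F 0))
    {e : Fin 3 →₀ ℕ} (he : e 2 = 0) :
    coeff e (subst multisetSubst (faceSeries (saturated F))) = coeff e 1 := by
  classical
  have ncard_eq {n : ℕ} (hn : n = 0) (a b : ℕ) :
      {m : Arrow n → ℕ | arrowSupport m ∈ saturated F n ∧ forwardCount m = a ∧
        backwardCount m = b}.ncard = if a = 0 ∧ b = 0 then 1 else 0 := by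
    subst hn
    have : IsEmpty (Arrow 0) := ⟨fun p => p.2 (Fin.ext (by omega))⟩
    have hmem (σ : Finset (Arrow 0)) : σ ∈ saturated F 0 := by
      rw [Finset.eq_empty_of_isEmpty σ]
      exact ⟨hC.empty_mem, Or.inl rfl⟩
    simp only [hmem, forwardCount, backwardCount]
    split_ifs with h
    · simp [h, Set.ncard_univ]
    · simp [h, eq_comm]
  have he0 : e = 0 ↔ e 0 = 0 ∧ e 1 = 0 :=
    ⟨by rintro rfl; simp, fun h => finsupp_fin_three_ext (by decide) (by decide) (by decide)
      h.1 h.2 he⟩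
  rw [coeff_subst_faceSeries, coeff_one, ncard_eq he, Nat.cast_ite, Nat.cast_one, Nat.cast_zero,
    if_congr he0 rfl rfl]

theorem faceSeries_eq_simionSeries (hst : s ≠ t) (hs : s ≠ 2) (ht : t ≠ 2)
    {F : Collection} (hC : IsSimplicialComplex (F 0))
    (hN : ∀ e : Fin 3 →₀ ℕ, e 2 ≠ 0 →
      {m : Arrow (e 2) → ℕ | arrowSupport m ∈ saturated F (e 2) ∧ forwardCount m = e 0 ∧
        backwardCount m = e 1}.ncard = (closedPaths (e 2 + 1) (e s) (e t)).ncard) :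
    faceSeries (saturated F) = simionSeries (X s) (X t) (X 2) := by
  classical
  have X_two_ne_zero : (X 2 : MvPowerSeries (Fin 3) ℚ) ≠ 0 := fun h => by
    simpa using congrArg (coeff (Finsupp.single 2 1)) h
  refine subst_multisetSubst_injective (sub_left_injective (b := 1)
    (mul_left_cancel₀ X_two_ne_zero (add_right_injective 1 ?_)))
  ext m
  refine Eq.trans ?_ (coeff_subst_simionSeries hst hs ht m).symm
  rw [map_add, ← pow_one (X 2), coeff_X_pow_mul_eq, map_sub]
  rcases Nat.lt_or_ge (m 2) 1 with hm | hm
  · have hm2 : m 2 = 0 := by omega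
    have hm0 : m = 0 ↔ m s = 0 ∧ m t = 0 :=
      ⟨by rintro rfl; simp, fun h => finsupp_fin_three_ext hst hs ht h.1 h.2 hm2⟩
    rw [if_neg (by omega), add_zero, coeff_one, hm2, ncard_closedPaths_zero, Nat.cast_ite,
      Nat.cast_one, Nat.cast_zero, if_congr hm0 rfl rfl]
  have hm0 : m ≠ 0 := by
    rintro rfl
    simp at hm
  rw [if_pos hm, coeff_one, if_neg hm0, zero_add]
  obtain ⟨e, rfl⟩ : ∃ e, m = e + Finsupp.single 2 1 :=
    ⟨_, (tsub_add_cancel_of_le (Finsupp.single_le_iff.2 hm)).symm⟩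
  rw [add_tsub_cancel_right]
  by_cases he : e 2 = 0
  · simp [coeff_subst_faceSeries_of_eq_zero hC he, he, closedPaths_one]
  · have he0 : e ≠ 0 := by
      rintro rfl
      exact he rfl
    rw [coeff_subst_faceSeries, hN e he, coeff_one, if_neg he0, sub_zero]
    simp [hs, ht]

end

lemma ncard_saturated_of_THTHNest {F : Collection} {n : ℕ} (hF : IsUniform F)
    (hC : IsSimplicialComplex (F n)) (hU : IsUnimodular (F n)) (hTHTH : THTHNest F)
    (hHTHT : ¬HTHTNest F) (hS : THHTCross F → HTTHCross F → TTHHNest F ∧ HHTTNest F)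
    (hn : n ≠ 0) (a b : ℕ) :
    {m : Arrow n → ℕ | arrowSupport m ∈ saturated F n ∧ forwardCount m = a ∧
      backwardCount m = b}.ncard = (closedPaths (n + 1) a b).ncard :=
  hU.ncard_saturated_eq_ncard_closedPaths hC hn
    (fun _ => exists_isCut_of_THTHNest hF hC hU hTHTH hHTHT hS) a b

lemma ncard_saturated_of_HTHTNest {F : Collection} {n : ℕ} (hF : IsUniform F)
    (hC : IsSimplicialComplex (F n)) (hU : IsUnimodular (F n)) (hTHTH : ¬THTHNest F)
    (hHTHT : HTHTNest F) (hS : THHTCross F → HTTHCross F → TTHHNest F ∧ HHTTNest F)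
    (hn : n ≠ 0) (a b : ℕ) :
    {m : Arrow n → ℕ | arrowSupport m ∈ saturated F n ∧ forwardCount m = a ∧
      backwardCount m = b}.ncard = (closedPaths (n + 1) b a).ncard := by
  rw [← ncard_saturated_rev]
  refine ncard_saturated_of_THTHNest hF.rev hC.rev hU.rev (THTHNest_rev.2 hHTHT)
    (fun h => hTHTH (HTHTNest_rev.1 h)) ?_ hn b a
  rw [THHTCross_rev, HTTHCross_rev, TTHHNest_rev, HHTTNest_rev]
  exact fun h h' => (hS h' h).symm

end RootPolytope

open RootPolytope in
theorem theorem7p1_general (F : Collection) (hC : ∀ n, IsSimplicialComplex (F n))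
    (hU : IsUniform F) (hT : ∀ n, TriangulatesBoundary (F n))
    (hS : THHTCross F → HTTHCross F → TTHHNest F ∧ HHTTNest F) :
    (THTHNest F ∧ ¬HTHTNest F → faceSeries (saturated F) =
      simionSeries (MvPowerSeries.X 0) (MvPowerSeries.X 1) (MvPowerSeries.X 2)) ∧
    (¬THTHNest F ∧ HTHTNest F → faceSeries (saturated F) =
      simionSeries (MvPowerSeries.X 1) (MvPowerSeries.X 0) (MvPowerSeries.X 2)) := by
  have unimodular (n) : IsUnimodular (F n) := ((hT n).isCompleteFan (hC n)).isUnimodular (hC n)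
  constructor
  · rintro ⟨hTHTH, hHTHT⟩
    exact faceSeries_eq_simionSeries (by decide) (by decide) (by decide) (hC 0) fun e he =>
      ncard_saturated_of_THTHNest hU (hC _) (unimodular _) hTHTH hHTHT hS he _ _
  · rintro ⟨hTHTH, hHTHT⟩
    exact faceSeries_eq_simionSeries (by decide) (by decide) (by decide) (hC 0) fun e he =>
      ncard_saturated_of_HTHTNest hU (hC _) (unimodular _) hTHTH hHTHT hS he _ _

theorem theorem7p1 (F : RootPolytope.Collection)
    (hF : RootPolytope.IsUniformFlagTriangulation F) (hS : RootPolytope.SimionClass F) :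
    (RootPolytope.THTHNest F ∧ ¬ RootPolytope.HTHTNest F →
      RootPolytope.faceSeries (RootPolytope.saturated F) =
        RootPolytope.simionSeries
          (MvPowerSeries.X 0) (MvPowerSeries.X 1) (MvPowerSeries.X 2)) ∧
    (¬ RootPolytope.THTHNest F ∧ RootPolytope.HTHTNest F →
      RootPolytope.faceSeries (RootPolytope.saturated F) =
        RootPolytope.simionSeries
          (MvPowerSeries.X 1) (MvPowerSeries.X 0) (MvPowerSeries.X 2)) :=
  theorem7p1_general F hF.complex hF.uniform hF.triangulates hS.2
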